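/- Let $(X,\mu,\varphi)$ and $(Y,\nu,\psi)$ be invertible measure-preserving systems, i.e. $(X,\mu)$ and $(Y,\nu)$ are probability spaces and $\varphi:X\to X$, $\psi:Y\to Y$ are bijective, measurable with measurable inverse, and measure-preserving. All $L^p$-spaces are complex, and $Tf=f\circ\varphi$, $Sg=g\circ\psi$ denote the Koopman operators. Let $(Y,\nu,\psi)$ be a (Markov) factor of $(X,\mu,\varphi)$: there is a linear operator $J:L^1(Y,\nu)\to L^1(X,\mu)$ that is positive, satisfies $J\mathbf 1=\mathbf 1$, $\int_X Jg\,d\mu=\int_Y g\,d\nu$ and $|Jg|=J|g|$ for all $g\in L^1(Y,\nu)$, and $JS=TJ$. Let $\mathbb E_Y:L^1(X,\mu)\to L^1(Y,\nu)$ be the conditional expectation operator, i.e. the adjoint of $J$, determined by $$\int_Y (\mathbb E_Y f)\, g\,d\nu=\int_X f\cdot Jg\,d\mu\qquad (f\in L^1(X,\mu),\ g\in L^\infty(Y,\nu)).$$ A function $f\in L^2(X,\mu)$ is called conditionally weakly mixing relative to $Y$ if $$\lim_{N\to\infty}\frac1N\sum_{n=1}^N\big\|\mathbb E_Y(T^nf\cdot\overline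 f)\big\|_{L^1(Y,\nu)}=0,$$ and $W(X|Y)$ denotes the set of all such $f$. Then $W(X|Y)\cap L^\infty(X,\mu)$ is dense in $W(X|Y)$ with respect to the $L^2$-norm. -/

import Mathlib

open MeasureTheory Filter Topology
open scoped ENNReal ComplexOrder ComplexConjugate

namespace CondErgodic

section Koopman

variable {X : Type*} [MeasurableSpace X] {μ : Measure X}

/-- The Koopman operator `T f = f ∘ φ` on the complex space `L^p(X, μ)`. -/
noncomputable def koopman (p : ℝ≥0∞) {φ : X ≃ᵐ X} (hφ : MeasurePreserving φ μ μ) :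
    Lp ℂ p μ → Lp ℂ p μ :=
  fun f => Lp.compMeasurePreserving φ hφ f

/-- The pointwise product `f · conj g ∈ L^1(X, μ)` of `f, g ∈ L^2(X, μ)`. -/
noncomputable def mulConj (f g : Lp ℂ 2 μ) : Lp ℂ 1 μ :=
  (memLp_one_iff_integrable.2
    ((L2.integrable_inner g f).congr
      (Eventually.of_forall fun x => RCLike.inner_apply (g x) (f x)) :
      Integrable (fun x => f x * conj (g x)) μ)).toLp _

end Koopman

section Markov

set_option linter.unusedSectionVars false

variable {X Y : Type*} [MeasurableSpace X] [MeasurableSpace Y]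
  {μ : Measure X} {ν : Measure Y} [IsProbabilityMeasure μ] [IsProbabilityMeasure ν]

/-- `J : L^1(Y, ν) → L^1(X, μ)` is a Markov homomorphism: it is positive, maps the constant
function `1` to `1`, preserves the integral, and preserves the absolute value. -/
structure IsMarkovHom (J : Lp ℂ 1 ν →L[ℂ] Lp ℂ 1 μ) : Prop where
  nonneg : ∀ f : Lp ℂ 1 ν, (∀ᵐ y ∂ν, 0 ≤ f y) → ∀ᵐ x ∂μ, 0 ≤ J f x
  map_one : J (Lp.const 1 ν (1 : ℂ)) = Lp.const 1 μ (1 : ℂ)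
  integral_eq : ∀ f : Lp ℂ 1 ν, ∫ x, J f x ∂μ = ∫ y, f y ∂ν
  map_abs : ∀ f g : Lp ℂ 1 ν, (∀ᵐ y ∂ν, g y = (‖f y‖ : ℂ)) → ∀ᵐ x ∂μ, J g x = (‖J f x‖ : ℂ)

/-- `J` is a Markov factor map from `(X, μ, φ)` to `(Y, ν, ψ)`: a Markov homomorphism that
intertwines the Koopman operators. -/
structure IsMarkovFactorMap {φ : X ≃ᵐ X} (hφ : MeasurePreserving φ μ μ)
    {ψ : Y ≃ᵐ Y} (hψ : MeasurePreserving ψ ν ν) (J : Lp ℂ 1 ν →L[ℂ] Lp ℂ 1 μ) : Prop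
    extends IsMarkovHom J where
  intertwine : ∀ f : Lp ℂ 1 ν, J (koopman 1 hψ f) = koopman 1 hφ (J f)

/-- `h = J' f`, where `J'` is the adjoint of `J`: one has `∫ h g dν = ∫ f (J g) dμ` for all
`g ∈ L^∞(Y, ν)`. -/
def IsCondExp (J : Lp ℂ 1 ν →L[ℂ] Lp ℂ 1 μ) (f : Lp ℂ 1 μ) (h : Lp ℂ 1 ν) : Prop :=
  ∀ g : Lp ℂ 1 ν, MemLp g ∞ ν → ∫ y, h y * g y ∂ν = ∫ x, f x * J g x ∂μ

variable {J : Lp ℂ 1 ν →L[ℂ] Lp ℂ 1 μ}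


theorem IsMarkovHom.norm_le (hJ : IsMarkovHom J) {g : Lp ℂ 1 ν} {C : ℝ}
    (hg : ∀ᵐ y ∂ν, ‖g y‖ ≤ C) : ∀ᵐ x ∂μ, ‖J g x‖ ≤ C := by
  have hm : MemLp (fun y => (‖g y‖ : ℂ)) 1 ν := (Lp.memLp g).norm.ofReal
  have hae : ∀ᵐ y ∂ν, hm.toLp _ y = (‖g y‖ : ℂ) := hm.coeFn_toLp
  have h1 := hJ.map_abs g (hm.toLp _) hae
  have h2 : ∀ᵐ y ∂ν, 0 ≤ ((C : ℂ) • Lp.const 1 ν (1 : ℂ) - hm.toLp _) y := by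
    filter_upwards [hae, hg, Lp.coeFn_sub ((C : ℂ) • Lp.const 1 ν (1 : ℂ)) (hm.toLp _),
      Lp.coeFn_smul (C : ℂ) (Lp.const 1 ν (1 : ℂ)), Lp.coeFn_const (p := 1) (μ := ν) (c := (1 : ℂ))]
      with y a b c d e
    rw [c, Pi.sub_apply, d, Pi.smul_apply, e, a]
    simp only [Function.const_apply, smul_eq_mul, mul_one, sub_nonneg]
    exact_mod_cast b
  have h3 := hJ.nonneg _ h2
  rw [map_sub, map_smul, hJ.map_one] at h3
  filter_upwards [h1, h3, Lp.coeFn_sub ((C : ℂ) • Lp.const 1 μ (1 : ℂ)) (J (hm.toLp _)),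
    Lp.coeFn_smul (C : ℂ) (Lp.const 1 μ (1 : ℂ)), Lp.coeFn_const (p := 1) (μ := μ) (c := (1 : ℂ))]
    with x a b c d e
  rw [c, Pi.sub_apply, d, Pi.smul_apply, e, a] at b
  simp only [Function.const_apply, smul_eq_mul, mul_one, sub_nonneg] at b
  exact_mod_cast b

theorem exists_bound {g : Lp ℂ 1 ν} (hg : MemLp g ∞ ν) :
    ∃ C : ℝ, ∀ᵐ y ∂ν, ‖g y‖ ≤ C := by
  refine ⟨(eLpNorm g ∞ ν).toReal, ?_⟩
  have h := ae_le_eLpNormEssSup (f := (g : Y → ℂ)) (μ := ν)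
  rw [← eLpNorm_exponent_top] at h
  filter_upwards [h] with y hy
  have := ENNReal.toReal_mono hg.2.ne hy
  simpa using this

/-- The adjoint of a Markov homomorphism is a contraction for the `L^1`-norms. -/
theorem IsCondExp.norm_le (hJ : IsMarkovHom J) {f : Lp ℂ 1 μ} {h : Lp ℂ 1 ν}
    (hfh : IsCondExp J f h) : ‖h‖ ≤ ‖f‖ := by
  set s : Y → ℂ := fun y => conj (h y) / (‖h y‖ : ℂ) with hs
  have hle : ∀ y, ‖s y‖ ≤ 1 := by
    intro y
    simp only [hs, norm_div, RCLike.norm_conj, Complex.norm_real, norm_norm]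
    exact div_self_le_one _
  have hsm : AEStronglyMeasurable s ν := by
    have := (Lp.memLp h).aestronglyMeasurable.aemeasurable
    apply AEMeasurable.aestronglyMeasurable
    apply AEMeasurable.div
    · exact Complex.continuous_conj.measurable.comp_aemeasurable this
    · exact Complex.measurable_ofReal.comp_aemeasurable this.norm
  have hsT : MemLp s ∞ ν := memLp_top_of_bound hsm 1 (Eventually.of_forall hle)
  have hs1 : MemLp s 1 ν := hsT.mono_exponent le_top
  have hcoe := hs1.coeFn_toLp
  have key := hfh (hs1.toLp s) ((memLp_congr_ae hcoe).2 hsT)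
  have e1 : ∫ y, h y * hs1.toLp s y ∂ν = (‖h‖ : ℂ) := by
    rw [L1.norm_eq_integral_norm, ← integral_complex_ofReal]
    apply integral_congr_ae
    filter_upwards [hcoe] with y hy
    rw [hy]
    simp only [hs]
    rw [← mul_div_assoc, Complex.mul_conj, Complex.normSq_eq_norm_sq]
    by_cases h0 : ‖h y‖ = 0
    · simp [h0]
    · have : (‖h y‖ : ℂ) ≠ 0 := by exact_mod_cast h0
      push_cast
      field_simp
  have hJb : ∀ᵐ x ∂μ, ‖J (hs1.toLp s) x‖ ≤ 1 :=
    hJ.norm_le (by filter_upwards [hcoe] with y hy; rw [hy]; exact hle y)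
  have e2 : ‖∫ x, f x * J (hs1.toLp s) x ∂μ‖ ≤ ‖f‖ := by
    rw [L1.norm_eq_integral_norm]
    apply norm_integral_le_of_norm_le (L1.integrable_coeFn f).norm
    filter_upwards [hJb] with x hx
    rw [norm_mul]
    exact mul_le_of_le_one_right (norm_nonneg _) hx
  rw [← key, e1] at e2
  simpa using e2

theorem integrable_mul_of_bound {g : Lp ℂ 1 ν} {k : Lp ℂ 1 ν} {C : ℝ}
    (hg : ∀ᵐ y ∂ν, ‖g y‖ ≤ C) : Integrable (fun y => k y * g y) ν :=
  (L1.integrable_coeFn k).mul_bdd (c := C) (Lp.memLp g).aestronglyMeasurable hg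

theorem IsCondExp.add (hJ : IsMarkovHom J) {f f' : Lp ℂ 1 μ} {h h' : Lp ℂ 1 ν}
    (H : IsCondExp J f h) (H' : IsCondExp J f' h') : IsCondExp J (f + f') (h + h') := by
  intro g hg
  obtain ⟨C, hC⟩ := exists_bound hg
  have hC' := hJ.norm_le hC
  calc ∫ y, (h + h') y * g y ∂ν = ∫ y, (h y * g y + h' y * g y) ∂ν := by
        apply integral_congr_ae
        filter_upwards [Lp.coeFn_add h h'] with y hy
        rw [hy, Pi.add_apply, add_mul]
    _ = ∫ x, (f x * J g x + f' x * J g x) ∂μ := by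
        rw [integral_add (integrable_mul_of_bound hC) (integrable_mul_of_bound hC),
          integral_add (integrable_mul_of_bound hC') (integrable_mul_of_bound hC'),
          H g hg, H' g hg]
    _ = ∫ x, (f + f') x * J g x ∂μ := by
        apply integral_congr_ae
        filter_upwards [Lp.coeFn_add f f'] with y hy
        rw [hy, Pi.add_apply, add_mul]

theorem IsCondExp.neg {f : Lp ℂ 1 μ} {h : Lp ℂ 1 ν}
    (H : IsCondExp J f h) : IsCondExp J (-f) (-h) := by
  intro g hg
  have e1 : ∫ y, (-h) y * g y ∂ν = ∫ y, -(h y * g y) ∂ν := by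
    apply integral_congr_ae
    filter_upwards [Lp.coeFn_neg h] with y hy
    rw [hy, Pi.neg_apply, neg_mul]
  have e2 : ∫ x, (-f) x * J g x ∂μ = ∫ x, -(f x * J g x) ∂μ := by
    apply integral_congr_ae
    filter_upwards [Lp.coeFn_neg f] with y hy
    rw [hy, Pi.neg_apply, neg_mul]
  rw [e1, e2, integral_neg, integral_neg, H g hg]

theorem tendsto_integral_mul {g : Lp ℂ 1 ν} {C : ℝ} (hg : ∀ᵐ y ∂ν, ‖g y‖ ≤ C)
    {u : ℕ → Lp ℂ 1 ν} {k : Lp ℂ 1 ν} (hu : Tendsto u atTop (𝓝 k)) :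
    Tendsto (fun n => ∫ y, u n y * g y ∂ν) atTop (𝓝 (∫ y, k y * g y ∂ν)) := by
  rw [tendsto_iff_norm_sub_tendsto_zero] at hu ⊢
  refine squeeze_zero (fun _ => norm_nonneg _) (fun n => ?_) (by simpa using hu.const_mul C)
  rw [← integral_sub (integrable_mul_of_bound hg) (integrable_mul_of_bound hg),
    L1.norm_eq_integral_norm, ← integral_const_mul]
  apply norm_integral_le_of_norm_le ((L1.integrable_coeFn _).norm.const_mul C)
  filter_upwards [hg, Lp.coeFn_sub (u n) k] with y hy hs
  rw [hs, Pi.sub_apply, ← sub_mul, norm_mul, mul_comm]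
  exact mul_le_mul_of_nonneg_right hy (norm_nonneg _)

theorem exists_isCondExp_of_bound (J : Lp ℂ 1 ν →L[ℂ] Lp ℂ 1 μ) {f : Lp ℂ 1 μ} {C : ℝ}
    (hf : ∀ᵐ x ∂μ, ‖f x‖ ≤ C) : ∃ h, IsCondExp J f h := by
  have hint : ∀ k : Lp ℂ 1 μ, Integrable (fun x => f x * k x) μ := fun k =>
    (integrable_mul_of_bound (k := k) hf).congr
      (Eventually.of_forall fun x => mul_comm _ _)
  have hC : 0 ≤ C := by
    obtain ⟨x, hx⟩ := hf.exists
    exact (norm_nonneg _).trans hx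
  have m1 : ∀ g : Lp ℂ 2 ν, MemLp g 1 ν := fun g => (Lp.memLp g).mono_exponent (by norm_num)
  let L : Lp ℂ 2 ν →ₗ[ℂ] ℂ :=
    { toFun := fun g => ∫ x, f x * J ((m1 g).toLp _) x ∂μ
      map_add' := by
        intro a b
        have : (m1 (a + b)).toLp _ = (m1 a).toLp _ + (m1 b).toLp _ := by
          rw [← MemLp.toLp_add]
          exact MemLp.toLp_congr _ _ (Lp.coeFn_add a b)
        rw [this, map_add, ← integral_add (hint _) (hint _)]
        apply integral_congr_ae
        filter_upwards [Lp.coeFn_add (J ((m1 a).toLp _)) (J ((m1 b).toLp _))] with x hx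
        rw [hx, Pi.add_apply, mul_add]
      map_smul' := by
        intro c a
        have : (m1 (c • a)).toLp _ = c • (m1 a).toLp _ := by
          rw [← MemLp.toLp_const_smul]
          exact MemLp.toLp_congr _ _ (Lp.coeFn_smul c a)
        rw [this, map_smul, RingHom.id_apply, smul_eq_mul, ← integral_const_mul]
        apply integral_congr_ae
        filter_upwards [Lp.coeFn_smul c (J ((m1 a).toLp _))] with x hx
        rw [hx, Pi.smul_apply, smul_eq_mul]
        ring }
  have hL : ∀ g, ‖L g‖ ≤ (C * ‖J‖) * ‖g‖ := by
    intro g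
    have a1 : ‖L g‖ ≤ C * ‖J ((m1 g).toLp _)‖ := by
      rw [L1.norm_eq_integral_norm, ← integral_const_mul]
      apply norm_integral_le_of_norm_le ((L1.integrable_coeFn _).norm.const_mul C)
      filter_upwards [hf] with x hx
      rw [norm_mul]
      exact mul_le_mul_of_nonneg_right hx (norm_nonneg _)
    have a2 : ‖(m1 g).toLp _‖ ≤ ‖g‖ := by
      rw [Lp.norm_toLp, Lp.norm_def]
      exact ENNReal.toReal_mono (Lp.memLp g).2.ne
        (eLpNorm_le_eLpNorm_of_exponent_le (by norm_num) (Lp.memLp g).1)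
    calc ‖L g‖ ≤ C * ‖J ((m1 g).toLp _)‖ := a1
      _ ≤ C * (‖J‖ * ‖(m1 g).toLp _‖) := by gcongr; exact J.le_opNorm _
      _ ≤ C * (‖J‖ * ‖g‖) := by gcongr
      _ = _ := by ring
  let Φ : StrongDual ℂ (Lp ℂ 2 ν) := L.mkContinuous _ hL
  let k : Lp ℂ 2 ν := (InnerProductSpace.toDual ℂ (Lp ℂ 2 ν)).symm Φ
  have hk : ∀ g, inner ℂ k g = L g := fun g => InnerProductSpace.toDual_symm_apply
  have mk : MemLp (fun y => conj (k y)) 1 ν := by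
    have := (m1 k).star
    exact this
  refine ⟨mk.toLp _, fun g hg => ?_⟩
  have g2 : MemLp g 2 ν := hg.mono_exponent le_top
  have e := hk (g2.toLp _)
  have e3 : (m1 (g2.toLp _)).toLp _ = g := by
    conv_rhs => rw [← Lp.toLp_coeFn g (Lp.memLp g)]
    exact MemLp.toLp_congr _ _ g2.coeFn_toLp
  have e4 : L (g2.toLp _) = ∫ x, f x * J g x ∂μ := by
    change ∫ x, f x * J ((m1 (g2.toLp _)).toLp _) x ∂μ = _
    rw [e3]
  rw [← e4, ← e, L2.inner_def]
  apply integral_congr_ae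
  filter_upwards [mk.coeFn_toLp, g2.coeFn_toLp] with y h1 h2
  rw [h1, h2, RCLike.inner_apply, mul_comm]

/-- Existence of the conditional expectation on all of `L^1(X, μ)`. -/
theorem exists_isCondExp (hJ : IsMarkovHom J) (f : Lp ℂ 1 μ) : ∃ h, IsCondExp J f h := by
  refine Lp.induction ENNReal.one_ne_top (fun f => ∃ h, IsCondExp J f h) ?_ ?_ ?_ f
  · intro c s hs hμs
    refine exists_isCondExp_of_bound J (C := ‖c‖) ?_
    rw [Lp.simpleFunc.coe_indicatorConst]
    filter_upwards [indicatorConstLp_coeFn (p := 1) (hs := hs) (hμs := hμs.ne) (c := c)] with x hx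
    rw [hx]
    exact norm_indicator_le_norm_self _ _
  · rintro a b ha hb - ⟨h, H⟩ ⟨h', H'⟩
    exact ⟨h + h', H.add hJ H'⟩
  · refine isClosed_of_closure_subset fun f hf => ?_
    obtain ⟨u, hu, hlim⟩ := mem_closure_iff_seq_limit.1 hf
    choose v hv using hu
    have hcau : CauchySeq v := by
      have hc := hlim.cauchySeq
      rw [Metric.cauchySeq_iff] at hc ⊢
      intro ε hε
      obtain ⟨N, hN⟩ := hc ε hε
      refine ⟨N, fun m hm n hn => lt_of_le_of_lt ?_ (hN m hm n hn)⟩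
      rw [dist_eq_norm, dist_eq_norm, sub_eq_add_neg, sub_eq_add_neg]
      exact ((hv m).add hJ (hv n).neg).norm_le hJ
    obtain ⟨h, hh⟩ := cauchySeq_tendsto_of_complete hcau
    refine ⟨h, fun g hg => ?_⟩
    obtain ⟨C, hC⟩ := exists_bound hg
    have t1 := tendsto_integral_mul hC hh
    have t2 := tendsto_integral_mul (hJ.norm_le hC) hlim
    refine tendsto_nhds_unique t1 (t2.congr fun n => (hv n g hg).symm)

theorem IsCondExp.unique (hJ : IsMarkovHom J) {f : Lp ℂ 1 μ} {h h' : Lp ℂ 1 ν}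
    (H : IsCondExp J f h) (H' : IsCondExp J f h') : h = h' := by
  have := (H.add hJ H'.neg).norm_le hJ
  rw [add_neg_cancel, norm_zero, ← sub_eq_add_neg] at this
  exact sub_eq_zero.1 (norm_le_zero_iff.1 this)

/-- The conditional expectation operator `E_Y = J' : L^1(X, μ) → L^1(Y, ν)`. -/
noncomputable def condExpY (hJ : IsMarkovHom J) (f : Lp ℂ 1 μ) : Lp ℂ 1 ν :=
  (exists_isCondExp hJ f).choose

theorem condExpY_spec (hJ : IsMarkovHom J) (f : Lp ℂ 1 μ) : IsCondExp J f (condExpY hJ f) :=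
  (exists_isCondExp hJ f).choose_spec

/-- The conditional scalar product `⟨f, g⟩_{L^2(X|Y)} = E_Y(f · conj g) ∈ L^1(Y, ν)`. -/
noncomputable def condInner (hJ : IsMarkovHom J) (f g : Lp ℂ 2 μ) : Lp ℂ 1 ν :=
  condExpY hJ (mulConj f g)

/-- The set `W(X|Y)` of conditionally weakly mixing functions: those `f ∈ L^2(X, μ)` with
`(1/N) ∑_{n=1}^N ‖⟨T^n f, f⟩_{L^2(X|Y)}‖_{L^1(Y)} → 0`. -/
def condWeakMixing {φ : X ≃ᵐ X} (hφ : MeasurePreserving φ μ μ) (hJ : IsMarkovHom J) :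
    Set (Lp ℂ 2 μ) :=
  {f | Tendsto (fun N : ℕ => (1 / (N : ℝ)) *
      ∑ n ∈ Finset.Icc 1 N, ‖condInner hJ ((koopman 2 hφ)^[n] f) f‖) atTop (𝓝 0)}

end Markov

end CondErgodic

/-! Truncating a function in `W(X|Y)` need not preserve weak mixing, so boundedness has to come from
a projection that is contractive both in L² and in L^∞. It is `1 - E(· | Z)` for a suitable
σ-algebra `Z` on `X` with two properties: every `f` in `W` satisfies `E(f | Z) = 0`, and every
bounded `f` with `E(f | Z) = 0` lies in `W`. Given `f` in `W`, take a simple `k` close to `f` in L²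
and put `g = k - E(k | Z)`. Then `g` is bounded and belongs to `W`, and `f - g = (f - k) - E(f - k |
Z)` has norm at most `2‖f - k‖` (`IsCondWeakMixing.exists_bounded_near`).

`Z` is the family of sets whose indicators multiply `W` into itself (`multiplierAlgebra`). It is a
σ-algebra because `W` is a closed subspace of L², which rests on `IsCondWeakMixing.tendsto_corr`:
the diagonal condition on `f` forces decay of the averaged correlations of `f` with every `h` in L².
Functions in `W` have integral zero, and applying this to `1_B f` with `B ∈ Z` gives the first
property.

For the second, average the kernels `T^n f ⊗ conj (T^n f)`. In the semi-inner product of the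
relatively independent self-joining of `X` over the factor, the mean ergodic theorem makes these
averages Cauchy and asymptotically invariant. Applied to `f` as integral operators they give bounded
functions `g_N` converging in L² to some `a`. Invariance says that every `T^n a` is approximated,
uniformly in `n`, by one fixed kernel acting on `T^n f`. Such an `a` is a multiplier of `W`
(`isMultiplier_of_kernel_approx`), hence `Z`-measurable, so `⟨f, a⟩ = 0`. But `⟨f, g_N⟩` is exactly
the average of `‖E(T^n f · conj f)‖₂²`, which therefore tends to zero, and `f` is in `W`.

All of this happens on `X`, relative to the σ-algebra of sets whose indicators lie in the range of
`J`. There `J E_Y` is an ordinary conditional expectation, and since `J` is isometric on L¹ the two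
notions of weak mixing agree (`mem_condWeakMixing_iff`). -/

namespace CondErgodic

/-! ### L² estimates for honest functions -/

section SquareIntegral

variable {X : Type*} {mX : MeasurableSpace X} {μ : Measure X}

/-- The squared `L²`-norm `∫ ‖f‖² dμ`. -/
noncomputable def sqInt (μ : Measure X) (f : X → ℂ) : ℝ := ∫ x, ‖f x‖ ^ 2 ∂μ

theorem sqInt_nonneg (f : X → ℂ) : 0 ≤ sqInt μ f := integral_nonneg fun _ => sq_nonneg _

theorem sqInt_congr {f g : X → ℂ} (h : f =ᵐ[μ] g) : sqInt μ f = sqInt μ g :=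
  integral_congr_ae (by filter_upwards [h] with x hx; rw [hx])

theorem integrable_norm_sq {f : X → ℂ} (hf : MemLp f 2 μ) : Integrable (fun x => ‖f x‖ ^ 2) μ :=
  hf.integrable_norm_pow (by norm_num)

theorem integrable_mul_two {f g : X → ℂ} (hf : MemLp f 2 μ) (hg : MemLp g 2 μ) :
    Integrable (fun x => f x * g x) μ :=
  hf.integrable_mul hg

theorem memLp_conj {f : X → ℂ} {p : ℝ≥0∞} (hf : MemLp f p μ) : MemLp (fun x => conj (f x)) p μ :=
  hf.star

theorem memLp_top_mul {f g : X → ℂ} {p : ℝ≥0∞} (hf : MemLp f ∞ μ) (hg : MemLp g p μ) :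
    MemLp (fun x => f x * g x) p μ :=
  MemLp.mul hg hf

theorem exists_bound_of_memLp_top {f : X → ℂ} (hf : MemLp f ∞ μ) :
    ∃ C : ℝ, 0 ≤ C ∧ ∀ᵐ x ∂μ, ‖f x‖ ≤ C := by
  refine ⟨(eLpNorm f ∞ μ).toReal, ENNReal.toReal_nonneg, ?_⟩
  have h := ae_le_eLpNormEssSup (f := f) (μ := μ)
  rw [← eLpNorm_exponent_top] at h
  filter_upwards [h] with y hy
  simpa using ENNReal.toReal_mono hf.2.ne hy

/-- The Cauchy–Schwarz inequality. -/
theorem integral_norm_mul_le {f g : X → ℂ} (hf : MemLp f 2 μ) (hg : MemLp g 2 μ) :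
    ∫ x, ‖f x‖ * ‖g x‖ ∂μ ≤ √(sqInt μ f) * √(sqInt μ g) := by
  have h := integral_mul_le_Lp_mul_Lq_of_nonneg (μ := μ) Real.HolderConjugate.two_two
    (f := fun x => ‖f x‖) (g := fun x => ‖g x‖) (Eventually.of_forall fun _ => norm_nonneg _)
    (Eventually.of_forall fun _ => norm_nonneg _) (by simpa using hf.norm) (by simpa using hg.norm)
  simpa [Real.sqrt_eq_rpow, sqInt] using h

theorem sqInt_add_le {f g : X → ℂ} (hf : MemLp f 2 μ) (hg : MemLp g 2 μ) :
    sqInt μ (fun x => f x + g x) ≤ 2 * sqInt μ f + 2 * sqInt μ g := by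
  simp only [sqInt]
  rw [← integral_const_mul, ← integral_const_mul, ← integral_add
    ((integrable_norm_sq hf).const_mul _) ((integrable_norm_sq hg).const_mul _)]
  refine integral_mono (integrable_norm_sq (hf.add hg))
    (((integrable_norm_sq hf).const_mul _).add ((integrable_norm_sq hg).const_mul _)) fun x => ?_
  have := norm_add_le (f x) (g x)
  simp only
  nlinarith [norm_nonneg (f x + g x), sq_nonneg (‖f x‖ - ‖g x‖)]

theorem sqInt_conj (f : X → ℂ) : sqInt μ (fun x => conj (f x)) = sqInt μ f := by simp [sqInt]

theorem sqInt_mul_le {f g : X → ℂ} {C : ℝ} (hf : ∀ᵐ x ∂μ, ‖f x‖ ≤ C) (hg : MemLp g 2 μ) :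
    sqInt μ (fun x => f x * g x) ≤ C ^ 2 * sqInt μ g := by
  simp only [sqInt]
  rw [← integral_const_mul]
  refine integral_mono_of_nonneg (Eventually.of_forall fun _ => sq_nonneg _)
    ((integrable_norm_sq hg).const_mul _) ?_
  filter_upwards [hf] with x hx
  simp only [norm_mul, mul_pow]
  gcongr

theorem sqInt_comp {φ : X → X} (hφ : MeasurePreserving φ μ μ) {f : X → ℂ} (hf : MemLp f 2 μ) :
    sqInt μ (fun x => f (φ x)) = sqInt μ f := by
  simp only [sqInt]
  have h := integral_map (μ := μ) hφ.measurable.aemeasurable (f := fun y => ‖f y‖ ^ 2)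
    (by rw [hφ.map_eq]; exact (integrable_norm_sq hf).aestronglyMeasurable)
  rw [hφ.map_eq] at h
  exact h.symm

theorem sqInt_eq_toReal {f : X → ℂ} (hf : MemLp f 2 μ) :
    sqInt μ f = (eLpNorm f 2 μ).toReal ^ 2 := by
  rw [sqInt, hf.eLpNorm_eq_integral_rpow_norm (by norm_num) (by norm_num),
    ENNReal.toReal_ofReal (by positivity), ← Real.rpow_natCast, ← Real.rpow_mul]
  · simp
  · positivity

theorem norm_integral_mul_le {f g : X → ℂ} (hf : MemLp f 2 μ) (hg : MemLp g 2 μ) :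
    ‖∫ x, f x * g x ∂μ‖ ≤ √(sqInt μ f) * √(sqInt μ g) := by
  refine (norm_integral_le_integral_norm _).trans ?_
  simpa only [norm_mul] using integral_norm_mul_le hf hg

end SquareIntegral

/-! ### Cesàro averages tending to zero -/

section Average

/-- The averages `(1/N) ∑_{n=1}^N a n`. -/
noncomputable def avg (a : ℕ → ℝ) (N : ℕ) : ℝ := (1 / (N : ℝ)) * ∑ n ∈ Finset.Icc 1 N, a n

theorem avg_nonneg {a : ℕ → ℝ} (ha : ∀ n, 0 ≤ a n) (N : ℕ) : 0 ≤ avg a N :=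
  mul_nonneg (by positivity) (Finset.sum_nonneg fun n _ => ha n)

theorem avg_mono {a b : ℕ → ℝ} (h : ∀ n, a n ≤ b n) (N : ℕ) : avg a N ≤ avg b N :=
  mul_le_mul_of_nonneg_left (Finset.sum_le_sum fun n _ => h n) (by positivity)

theorem avg_add (a b : ℕ → ℝ) (N : ℕ) : avg (fun n => a n + b n) N = avg a N + avg b N := by
  simp [avg, Finset.sum_add_distrib, mul_add]

theorem avg_const_mul (c : ℝ) (a : ℕ → ℝ) (N : ℕ) : avg (fun n => c * a n) N = c * avg a N := by
  simp only [avg, ← Finset.mul_sum]; ring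

theorem avg_const {N : ℕ} (hN : N ≠ 0) (c : ℝ) : avg (fun _ => c) N = c := by
  have : (N : ℝ) ≠ 0 := by exact_mod_cast hN
  simp [avg]; field_simp

theorem avg_const_le {c : ℝ} (hc : 0 ≤ c) (N : ℕ) : avg (fun _ => c) N ≤ c := by
  rcases eq_or_ne N 0 with rfl | h
  · simpa [avg] using hc
  · exact (avg_const h c).le

/-- Averages tend to zero if the sequence is dominated, up to small errors, by sequences whose
averages tend to zero. -/
theorem tendsto_avg_zero_of_approx {a : ℕ → ℝ} (ha : ∀ n, 0 ≤ a n)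
    (h : ∀ ε > 0, ∃ b : ℕ → ℝ, Tendsto (avg b) atTop (𝓝 0) ∧ ∀ n, a n ≤ b n + ε) :
    Tendsto (avg a) atTop (𝓝 0) := by
  rw [Metric.tendsto_atTop]
  intro ε hε
  obtain ⟨b, hb, hab⟩ := h (ε / 2) (half_pos hε)
  obtain ⟨N₀, hN₀⟩ := Metric.tendsto_atTop.1 hb (ε / 2) (half_pos hε)
  refine ⟨N₀, fun N hN => ?_⟩
  have h1 := hN₀ N hN
  rw [Real.dist_eq, sub_zero] at h1 ⊢
  rw [abs_of_nonneg (avg_nonneg ha N)]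
  have h2 := avg_mono hab N
  rw [avg_add] at h2
  have h3 := avg_const_le (half_pos hε).le N
  have h4 := le_abs_self (avg b N)
  linarith

theorem tendsto_avg_zero_of_le {a b : ℕ → ℝ} (ha : ∀ n, 0 ≤ a n) (hab : ∀ n, a n ≤ b n)
    (hb : Tendsto (avg b) atTop (𝓝 0)) : Tendsto (avg a) atTop (𝓝 0) :=
  squeeze_zero (avg_nonneg ha) (avg_mono hab) hb

theorem tendsto_avg_zero_add {a b : ℕ → ℝ} (ha : Tendsto (avg a) atTop (𝓝 0))
    (hb : Tendsto (avg b) atTop (𝓝 0)) : Tendsto (avg fun n => a n + b n) atTop (𝓝 0) := by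
  simpa [funext (avg_add a b)] using ha.add hb

theorem tendsto_avg_zero_const_mul {a : ℕ → ℝ} (c : ℝ) (ha : Tendsto (avg a) atTop (𝓝 0)) :
    Tendsto (avg fun n => c * a n) atTop (𝓝 0) := by
  simpa [funext (avg_const_mul c a)] using ha.const_mul c

theorem tendsto_avg_zero_sum {ι : Type*} (s : Finset ι) {a : ι → ℕ → ℝ}
    (ha : ∀ i ∈ s, Tendsto (avg (a i)) atTop (𝓝 0)) :
    Tendsto (avg fun n => ∑ i ∈ s, a i n) atTop (𝓝 0) := by
  classical
  induction s using Finset.induction_on with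
  | empty =>
    have : (avg fun _ => (0 : ℝ)) = fun _ => 0 := by ext; simp [avg]
    simp [this]
  | insert i s hi ih =>
    simp only [Finset.sum_insert hi]
    exact tendsto_avg_zero_add (ha i (by simp)) (ih fun j hj => ha j (by simp [hj]))

/-- For fixed `n`, each value of `|n - k|` is taken at most once with `k ≤ n` and at most once with
`k > n`. So the inner sum is at most `2 (r 0 + ∑ r j)`, and the double average is bounded by twice
`r 0 / N + avg r N`. -/
theorem tendsto_double_avg_zero {r : ℕ → ℝ} (hr : ∀ n, 0 ≤ r n)
    (h : Tendsto (avg r) atTop (𝓝 0)) :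
    Tendsto (fun N : ℕ => (1 / (N : ℝ)) ^ 2 * ∑ n ∈ Finset.Icc 1 N, ∑ k ∈ Finset.Icc 1 N,
      (if k ≤ n then r (n - k) else r (k - n))) atTop (𝓝 0) := by
  have hle : ∀ N : ℕ, ∀ n ∈ Finset.Icc 1 N, ∑ k ∈ Finset.Icc 1 N,
      (if k ≤ n then r (n - k) else r (k - n)) ≤ 2 * (r 0 + ∑ j ∈ Finset.Icc 1 N, r j) := by
    intro N n hn
    rw [Finset.mem_Icc] at hn
    have e0 : r 0 + ∑ j ∈ Finset.Icc 1 N, r j = ∑ j ∈ Finset.range (N + 1), r j := by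
      rw [Finset.sum_range_succ', add_comm, Finset.range_eq_Ico, Finset.sum_Ico_add' r 0 N 1]
      rfl
    rw [e0, Finset.sum_ite, two_mul]
    refine add_le_add ?_ ?_
    · rw [← Finset.sum_image (f := r) (g := fun k => n - k)]
      · refine Finset.sum_le_sum_of_subset_of_nonneg ?_ fun _ _ _ => hr _
        intro j hj
        simp only [Finset.mem_image, Finset.mem_filter, Finset.mem_Icc, Finset.mem_range] at hj ⊢
        omega
      · intro a ha b hb hab
        simp only [Finset.coe_filter, Finset.mem_Icc, Set.mem_ofPred_eq] at ha hb hab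
        omega
    · rw [← Finset.sum_image (f := r) (g := fun k => k - n)]
      · refine Finset.sum_le_sum_of_subset_of_nonneg ?_ fun _ _ _ => hr _
        intro j hj
        simp only [Finset.mem_image, Finset.mem_filter, Finset.mem_Icc, Finset.mem_range] at hj ⊢
        omega
      · intro a ha b hb hab
        simp only [Finset.coe_filter, Finset.mem_Icc, Set.mem_ofPred_eq] at ha hb hab
        omega
  have hlim : Tendsto (fun N : ℕ => 2 * (r 0 * (1 / (N : ℝ)) + avg r N)) atTop (𝓝 0) := by
    have := ((tendsto_one_div_atTop_nhds_zero_nat (𝕜 := ℝ)).const_mul (r 0)).add h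
    simpa using this.const_mul 2
  refine squeeze_zero (fun N => ?_) (fun N => ?_) hlim
  · refine mul_nonneg (by positivity) (Finset.sum_nonneg fun n _ => Finset.sum_nonneg fun k _ => ?_)
    split_ifs <;> exact hr _
  · rcases eq_or_ne N 0 with rfl | hN
    · simp [avg]
    have hN' : (N : ℝ) ≠ 0 := by exact_mod_cast hN
    calc _ ≤ (1 / (N : ℝ)) ^ 2 * ∑ n ∈ Finset.Icc 1 N, 2 * (r 0 + ∑ j ∈ Finset.Icc 1 N, r j) := by
          gcongr with n hn
          exact hle N n hn
      _ = _ := by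
          simp only [Finset.sum_const, Nat.card_Icc, avg, nsmul_eq_mul, Nat.add_sub_cancel]
          field_simp

end Average

/-! ### Pulling measurable factors out of conditional expectations -/

section CondExp

variable {X : Type*} {m mX : MeasurableSpace X} {μ : Measure X}

theorem condExp_mul_left {f g : X → ℂ} (hf : AEStronglyMeasurable[m] f μ)
    (hfg : Integrable (fun x => f x * g x) μ) (hg : Integrable g μ) :
    μ[fun x => f x * g x | m] =ᵐ[μ] fun x => f x * (μ[g | m]) x :=
  condExp_bilin_of_aestronglyMeasurable_left (ContinuousLinearMap.mul ℝ ℂ) hf hfg hg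

theorem condExp_conj {f : X → ℂ} (hf : Integrable f μ) :
    μ[fun x => conj (f x) | m] =ᵐ[μ] fun x => conj ((μ[f | m]) x) :=
  (ContinuousLinearMap.comp_condExp_comm (m := m) hf Complex.conjCLE.toContinuousLinearMap).symm

theorem condExp_const_mul {f : X → ℂ} (c : ℂ) :
    μ[fun x => c * f x | m] =ᵐ[μ] fun x => c * (μ[f | m]) x :=
  condExp_smul c f m

theorem integral_mul_condExp_eq (hm : m ≤ mX) [SigmaFinite (μ.trim hm)] {f g : X → ℂ}
    (hf : AEStronglyMeasurable[m] f μ) (hfg : Integrable (fun x => f x * g x) μ)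
    (hg : Integrable g μ) : ∫ x, f x * (μ[g | m]) x ∂μ = ∫ x, f x * g x ∂μ := by
  rw [← integral_congr_ae (condExp_mul_left hf hfg hg), integral_condExp hm]

/-- Since `f` is `m`-measurable, `g` may be replaced by its conditional expectation before taking
absolute values. This is what lets conditional correlations control ordinary ones. -/
theorem norm_integral_mul_le_of_norm_le_one (hm : m ≤ mX) [SigmaFinite (μ.trim hm)] {f g : X → ℂ}
    (hf : AEStronglyMeasurable[m] f μ) (hf1 : ∀ x, ‖f x‖ ≤ 1) (hg : Integrable g μ) :
    ‖∫ x, f x * g x ∂μ‖ ≤ ∫ x, ‖(μ[g | m]) x‖ ∂μ := by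
  rw [← integral_mul_condExp_eq hm hf (hg.bdd_mul (c := 1) (hf.mono hm)
    (Eventually.of_forall hf1)) hg]
  refine norm_integral_le_of_norm_le integrable_condExp.norm (Eventually.of_forall fun x => ?_)
  rw [norm_mul]
  exact mul_le_of_le_one_left (norm_nonneg _) (hf1 x)

end CondExp

/-! ### Conditionally weakly mixing functions form a closed subspace -/

section WeakMixing

variable {X : Type*} {m mX : MeasurableSpace X} {μ : Measure X} {φ : X → X}

/-- The measure-preserving map `φ` and the `σ`-algebra `m` define a factor: the conditional
expectation onto `m` commutes with composition with `φ`. -/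
structure IsFactorAlgebra (m : MeasurableSpace X) {mX : MeasurableSpace X} (μ : Measure X)
    (φ : X → X) : Prop where
  le : m ≤ mX
  mp : MeasurePreserving φ μ μ
  condExp_comp : ∀ f : X → ℂ, Integrable f μ →
    μ[fun x => f (φ x) | m] =ᵐ[μ] fun x => (μ[f | m]) (φ x)

theorem memLp_comp (hφ : MeasurePreserving φ μ μ) {p : ℝ≥0∞} {f : X → ℂ} (hf : MemLp f p μ) :
    MemLp (fun x => f (φ x)) p μ :=
  hf.comp_measurePreserving hφ

theorem integrable_comp (hφ : MeasurePreserving φ μ μ) {f : X → ℂ} (hf : Integrable f μ) :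
    Integrable (fun x => f (φ x)) μ :=
  hφ.integrable_comp_of_integrable hf

theorem integral_comp_eq {E : Type*} [NormedAddCommGroup E] [NormedSpace ℝ E]
    (hφ : MeasurePreserving φ μ μ) {f : X → E}
    (hf : AEStronglyMeasurable f μ) : ∫ x, f (φ x) ∂μ = ∫ x, f x ∂μ := by
  have h := integral_map (μ := μ) hφ.measurable.aemeasurable (f := f) (by rwa [hφ.map_eq])
  rw [hφ.map_eq] at h
  exact h.symm

theorem IsFactorAlgebra.iterate (H : IsFactorAlgebra m μ φ) (n : ℕ) :
    IsFactorAlgebra m μ φ^[n] := by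
  refine ⟨H.le, H.mp.iterate n, ?_⟩
  induction n with
  | zero => exact fun f _ => Eventually.of_forall fun _ => rfl
  | succ n ih =>
    intro f hf
    have h1 := H.condExp_comp _ (integrable_comp (H.mp.iterate n) hf)
    have h2 := H.mp.quasiMeasurePreserving.ae (ih f hf)
    filter_upwards [h1, h2] with x h1 h2
    simp only [Function.iterate_succ_apply] at h1 ⊢
    rw [h1, h2]

/-- The conditional correlation `∫ |E(f ∘ φⁿ · conj h | m)| dμ`. -/
noncomputable def corr (m : MeasurableSpace X) {mX : MeasurableSpace X} (μ : Measure X)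
    (φ : X → X) (f h : X → ℂ) (n : ℕ) : ℝ :=
  ∫ x, ‖(μ[fun x => f (φ^[n] x) * conj (h x) | m]) x‖ ∂μ

/-- A function that is conditionally weakly mixing relative to `m`. -/
def IsCondWeakMixing (m : MeasurableSpace X) {mX : MeasurableSpace X} (μ : Measure X)
    (φ : X → X) (f : X → ℂ) : Prop :=
  MemLp f 2 μ ∧ Tendsto (avg (corr m μ φ f f)) atTop (𝓝 0)

theorem corr_nonneg (f h : X → ℂ) (n : ℕ) : 0 ≤ corr m μ φ f h n :=
  integral_nonneg fun _ => norm_nonneg _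

theorem integrable_corr (hφ : MeasurePreserving φ μ μ) {f h : X → ℂ} (hf : MemLp f 2 μ)
    (hh : MemLp h 2 μ) (n : ℕ) : Integrable (fun x => f (φ^[n] x) * conj (h x)) μ :=
  integrable_mul_two (memLp_comp (hφ.iterate n) hf) (memLp_conj hh)

theorem corr_le (hφ : MeasurePreserving φ μ μ) {f h : X → ℂ} (hf : MemLp f 2 μ)
    (hh : MemLp h 2 μ) (n : ℕ) : corr m μ φ f h n ≤ √(sqInt μ f) * √(sqInt μ h) := by
  refine (integral_norm_condExp_le _).trans ?_
  have := integral_norm_mul_le (memLp_comp (hφ.iterate n) hf) hh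
  rw [sqInt_comp (hφ.iterate n) hf] at this
  simpa [norm_mul] using this

theorem integral_norm_condExp_add_le {f g : X → ℂ} (hf : Integrable f μ) (hg : Integrable g μ) :
    ∫ x, ‖(μ[fun x => f x + g x | m]) x‖ ∂μ ≤
      ∫ x, ‖(μ[f | m]) x‖ ∂μ + ∫ x, ‖(μ[g | m]) x‖ ∂μ := by
  rw [← integral_add integrable_condExp.norm integrable_condExp.norm]
  refine integral_mono_ae integrable_condExp.norm
    (integrable_condExp.norm.add integrable_condExp.norm) ?_
  filter_upwards [condExp_add hf hg m] with x hx
  have : (μ[fun x => f x + g x | m]) x = (μ[f | m]) x + (μ[g | m]) x := hx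
  rw [this]
  exact norm_add_le _ _

theorem corr_add_left_le (hφ : MeasurePreserving φ μ μ) {f g h : X → ℂ} (hf : MemLp f 2 μ)
    (hg : MemLp g 2 μ) (hh : MemLp h 2 μ) (n : ℕ) :
    corr m μ φ (fun x => f x + g x) h n ≤ corr m μ φ f h n + corr m μ φ g h n := by
  have := integral_norm_condExp_add_le (m := m) (integrable_corr hφ hf hh n)
    (integrable_corr hφ hg hh n)
  simpa only [corr, add_mul] using this

theorem corr_add_right_le (hφ : MeasurePreserving φ μ μ) {f g h : X → ℂ} (hf : MemLp f 2 μ)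
    (hg : MemLp g 2 μ) (hh : MemLp h 2 μ) (n : ℕ) :
    corr m μ φ h (fun x => f x + g x) n ≤ corr m μ φ h f n + corr m μ φ h g n := by
  have := integral_norm_condExp_add_le (m := m) (integrable_corr hφ hh hf n)
    (integrable_corr hφ hh hg n)
  simpa only [corr, map_add, mul_add] using this

theorem corr_const_mul (c : ℂ) (f h : X → ℂ) (n : ℕ) :
    corr m μ φ (fun x => c * f x) h n = ‖c‖ * corr m μ φ f h n := by
  simp only [corr]
  rw [← integral_const_mul]
  refine integral_congr_ae ?_
  filter_upwards [condExp_const_mul (m := m) (μ := μ) c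
    (f := fun x => f (φ^[n] x) * conj (h x))] with x hx
  simp only [← mul_assoc] at hx
  rw [hx, norm_mul]

theorem corr_conj (hφ : MeasurePreserving φ μ μ) {f h : X → ℂ} (hf : MemLp f 2 μ)
    (hh : MemLp h 2 μ) (n : ℕ) :
    corr m μ φ (fun x => conj (f x)) (fun x => conj (h x)) n = corr m μ φ f h n := by
  refine integral_congr_ae ?_
  filter_upwards [condExp_conj (m := m) (integrable_corr hφ hf hh n)] with x hx
  simp only [map_mul] at hx
  rw [hx, RCLike.norm_conj]

/-- The common power of `φ` can be taken out of the conditional expectation and then removed by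
invariance of `μ`. For `k > n`, conjugation exchanges the roles of the two indices. -/
theorem IsFactorAlgebra.corr_shift (H : IsFactorAlgebra m μ φ) {f : X → ℂ} (hf : MemLp f 2 μ)
    (n k : ℕ) : ∫ x, ‖(μ[fun x => f (φ^[n] x) * conj (f (φ^[k] x)) | m]) x‖ ∂μ =
      if k ≤ n then corr m μ φ f f (n - k) else corr m μ φ f f (k - n) := by
  have key : ∀ n k : ℕ, k ≤ n →
      ∫ x, ‖(μ[fun x => f (φ^[n] x) * conj (f (φ^[k] x)) | m]) x‖ ∂μ =
        corr m μ φ f f (n - k) := by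
    intro n k hkn
    have h1 := (H.iterate k).condExp_comp _ (integrable_corr H.mp hf hf (n - k))
    simp only [← Function.iterate_add_apply, Nat.sub_add_cancel hkn] at h1
    rw [integral_congr_ae (by filter_upwards [h1] with x hx; rw [hx]),
      integral_comp_eq (H.iterate k).mp integrable_condExp.norm.aestronglyMeasurable]
    rfl
  split_ifs with h
  · exact key n k h
  · rw [← key k n (by omega)]
    refine integral_congr_ae ?_
    have hi : Integrable (fun x => f (φ^[k] x) * conj (f (φ^[n] x))) μ :=
      integrable_mul_two (memLp_comp (H.mp.iterate k) hf) (memLp_conj (memLp_comp (H.mp.iterate n) hf))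
    filter_upwards [condExp_conj (m := m) hi] with x hx
    simp only [map_mul, Complex.conj_conj] at hx
    rw [← RCLike.norm_conj ((μ[fun x => f (φ^[k] x) * conj (f (φ^[n] x)) | m]) x), ← hx]
    simp only [mul_comm]

theorem isCondWeakMixing_zero : IsCondWeakMixing m μ φ fun _ => 0 := by
  refine ⟨MemLp.zero, ?_⟩
  have : corr m μ φ (fun _ => 0) (fun _ => 0) = fun _ => 0 := by
    ext n
    have h0 : (μ[fun _ : X => (0 : ℂ) | m]) = 0 := condExp_zero
    simp [corr, h0]
  rw [this]
  exact tendsto_avg_zero_sum (ι := Empty) ∅ (a := fun _ _ => 0) (by simp)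

theorem IsCondWeakMixing.conj (H : IsFactorAlgebra m μ φ) {f : X → ℂ}
    (hf : IsCondWeakMixing m μ φ f) : IsCondWeakMixing m μ φ fun x => conj (f x) := by
  refine ⟨memLp_conj hf.1, ?_⟩
  rw [funext (corr_conj H.mp hf.1 hf.1)]
  exact hf.2

variable [IsProbabilityMeasure μ]

/-- A conditionally weakly mixing function has vanishing averaged conditional correlations with
every square-integrable function. -/
theorem IsCondWeakMixing.tendsto_corr (H : IsFactorAlgebra m μ φ) {f h : X → ℂ}
    (hf : IsCondWeakMixing m μ φ f) (hh : MemLp h 2 μ) :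
    Tendsto (avg (corr m μ φ f h)) atTop (𝓝 0) := by
  set e : ℕ → X → ℂ := fun n => μ[fun x => f (φ^[n] x) * conj (h x) | m] with he
  -- An `m`-measurable phase with `c n * e n = ‖e n‖`, equal to `0` where `e n` vanishes. It turns
  -- `corr f h n` into the inner product of `c n * f ∘ φⁿ` with the fixed function `h`.
  set c : ℕ → X → ℂ := fun n x => conj (e n x) / (‖e n x‖ : ℂ) with hc
  have hcm : ∀ n, StronglyMeasurable[m] (c n) := by
    intro n
    have h1 : Measurable[m] (e n) := stronglyMeasurable_condExp.measurable
    have h2 : Measurable fun z : ℂ => conj z / (‖z‖ : ℂ) :=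
      Complex.continuous_conj.measurable.div (Complex.measurable_ofReal.comp measurable_norm)
    exact (h2.comp h1).stronglyMeasurable
  have hc1 : ∀ n x, ‖c n x‖ ≤ 1 := by
    intro n x
    simp only [hc, norm_div, RCLike.norm_conj, Complex.norm_real, norm_norm]
    exact div_self_le_one _
  have hce : ∀ n x, c n x * e n x = (‖e n x‖ : ℂ) := by
    intro n x
    simp only [hc]
    rcases eq_or_ne (e n x) 0 with h0 | h0
    · simp [h0]
    · have : (‖e n x‖ : ℂ) ≠ 0 := by exact_mod_cast norm_ne_zero_iff.2 h0
      rw [div_mul_eq_mul_div, mul_comm, Complex.mul_conj, Complex.normSq_eq_norm_sq]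
      push_cast
      field_simp
  have hcT : ∀ n, MemLp (c n) ∞ μ := fun n =>
    memLp_top_of_bound ((hcm n).mono H.le).aestronglyMeasurable 1 (Eventually.of_forall (hc1 n))
  have hfn : ∀ n, MemLp (fun x => f (φ^[n] x)) 2 μ := fun n => memLp_comp (H.mp.iterate n) hf.1
  have hcf : ∀ n, MemLp (fun x => c n x * f (φ^[n] x)) 2 μ := fun n => memLp_top_mul (hcT n) (hfn n)
  have hcorr : ∀ n, (corr m μ φ f h n : ℂ) = ∫ x, c n x * f (φ^[n] x) * conj (h x) ∂μ := by
    intro n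
    have hi := integrable_corr H.mp hf.1 hh n
    have h1 := integral_mul_condExp_eq (μ := μ) H.le (f := c n) (hcm n).aestronglyMeasurable
      (hi.bdd_mul (c := 1) ((hcm n).mono H.le).aestronglyMeasurable
        (Eventually.of_forall (hc1 n))) hi
    simp only [mul_assoc]
    rw [← h1, corr, ← integral_complex_ofReal]
    exact integral_congr_ae (Eventually.of_forall fun x => (hce n x).symm)
  set F : ℕ → X → ℂ := fun N x => ∑ n ∈ Finset.Icc 1 N, c n x * f (φ^[n] x) with hF
  have hFm : ∀ N, MemLp (F N) 2 μ := fun N => memLp_finsetSum _ fun n _ => hcf n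
  have hsum : ∀ N, ∑ n ∈ Finset.Icc 1 N, corr m μ φ f h n ≤ √(sqInt μ (F N)) * √(sqInt μ h) := by
    intro N
    have h1 : ((∑ n ∈ Finset.Icc 1 N, corr m μ φ f h n : ℝ) : ℂ) =
        ∫ x, F N x * conj (h x) ∂μ := by
      push_cast
      simp only [hcorr, hF, Finset.sum_mul]
      rw [integral_finsetSum _ fun n _ => integrable_mul_two (hcf n) (memLp_conj hh)]
    have h2 := norm_integral_mul_le (hFm N) (memLp_conj hh)
    rw [← h1, sqInt_conj, Complex.norm_real] at h2
    exact (le_abs_self _).trans h2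
  -- In the expansion of `‖F N‖²` the phases enter as `c n * conj (c k)`, which is `m`-measurable
  -- and bounded by one. They cost nothing, and only the self-correlations of `f` remain.
  have hsq : ∀ N, sqInt μ (F N) ≤ ∑ n ∈ Finset.Icc 1 N, ∑ k ∈ Finset.Icc 1 N,
      (if k ≤ n then corr m μ φ f f (n - k) else corr m μ φ f f (k - n)) := by
    intro N
    have hint : ∀ n k, Integrable (fun x => (c n x * conj (c k x)) *
        (f (φ^[n] x) * conj (f (φ^[k] x)))) μ := fun n k =>
      (integrable_mul_two (hcf n) (memLp_conj (hcf k))).congr (Eventually.of_forall fun x => by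
        simp only [map_mul]; ring)
    have h1 : (sqInt μ (F N) : ℂ) = ∑ n ∈ Finset.Icc 1 N, ∑ k ∈ Finset.Icc 1 N,
        ∫ x, (c n x * conj (c k x)) * (f (φ^[n] x) * conj (f (φ^[k] x))) ∂μ := by
      rw [sqInt, ← integral_complex_ofReal]
      simp only [← integral_finsetSum _ fun k _ => hint _ k]
      rw [← integral_finsetSum _ fun n _ => integrable_finsetSum _ fun k _ => hint n k]
      refine integral_congr_ae (Eventually.of_forall fun x => ?_)
      simp only
      rw [Complex.ofReal_pow, ← Complex.mul_conj', map_sum, Finset.sum_mul_sum]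
      refine Finset.sum_congr rfl fun n _ => Finset.sum_congr rfl fun k _ => ?_
      simp only [map_mul]; ring
    have h2 : sqInt μ (F N) = ‖(sqInt μ (F N) : ℂ)‖ := by
      rw [Complex.norm_real, Real.norm_of_nonneg (sqInt_nonneg _)]
    rw [h2, h1]
    refine (norm_sum_le _ _).trans (Finset.sum_le_sum fun n _ => (norm_sum_le _ _).trans
      (Finset.sum_le_sum fun k _ => ?_))
    rw [← H.corr_shift hf.1 n k]
    refine norm_integral_mul_le_of_norm_le_one H.le (f := fun x => c n x * conj (c k x)) ?_ ?_ ?_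
    · exact ((hcm n).mul (Complex.continuous_conj.comp_stronglyMeasurable
        (hcm k))).aestronglyMeasurable
    · intro x
      rw [norm_mul, RCLike.norm_conj]
      exact mul_le_one₀ (hc1 n x) (norm_nonneg _) (hc1 k x)
    · exact integrable_mul_two (hfn n) (memLp_conj (hfn k))
  have hlim := tendsto_double_avg_zero (corr_nonneg (m := m) (μ := μ) (φ := φ) f f) hf.2
  have hlim2 := (hlim.sqrt).mul_const (√(sqInt μ h))
  rw [Real.sqrt_zero, zero_mul] at hlim2
  refine squeeze_zero (avg_nonneg (corr_nonneg f h)) (fun N => ?_) hlim2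
  rw [Real.sqrt_mul (by positivity), Real.sqrt_sq (by positivity), mul_assoc]
  refine mul_le_mul_of_nonneg_left ((hsum N).trans ?_) (by positivity)
  gcongr
  exact hsq N

/-- The defining condition is quadratic, but by `IsCondWeakMixing.tendsto_corr` each summand may be
tested against the whole sum, where the correlation is subadditive. -/
theorem IsCondWeakMixing.add (H : IsFactorAlgebra m μ φ) {f g : X → ℂ}
    (hf : IsCondWeakMixing m μ φ f) (hg : IsCondWeakMixing m μ φ g) :
    IsCondWeakMixing m μ φ fun x => f x + g x := by
  have hs : MemLp (fun x => f x + g x) 2 μ := hf.1.add hg.1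
  exact ⟨hs, tendsto_avg_zero_of_le (corr_nonneg _ _)
    (fun n => corr_add_left_le H.mp hf.1 hg.1 hs n)
    (tendsto_avg_zero_add (hf.tendsto_corr H hs) (hg.tendsto_corr H hs))⟩

theorem IsCondWeakMixing.const_mul (H : IsFactorAlgebra m μ φ) {f : X → ℂ} (c : ℂ)
    (hf : IsCondWeakMixing m μ φ f) : IsCondWeakMixing m μ φ fun x => c * f x := by
  have hs : MemLp (fun x => c * f x) 2 μ := hf.1.const_mul c
  refine ⟨hs, ?_⟩
  rw [funext (corr_const_mul c f _)]
  exact tendsto_avg_zero_const_mul _ (hf.tendsto_corr H hs)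

theorem IsCondWeakMixing.sub (H : IsFactorAlgebra m μ φ) {f g : X → ℂ}
    (hf : IsCondWeakMixing m μ φ f) (hg : IsCondWeakMixing m μ φ g) :
    IsCondWeakMixing m μ φ fun x => f x - g x := by
  simpa [sub_eq_add_neg] using hf.add H (hg.const_mul H (-1))

/-- The conditionally weakly mixing functions form a closed subset of `L²`. -/
theorem IsCondWeakMixing.of_approx (H : IsFactorAlgebra m μ φ) {f : X → ℂ} (hf : MemLp f 2 μ)
    (h : ∀ ε > 0, ∃ g, IsCondWeakMixing m μ φ g ∧ sqInt μ (fun x => f x - g x) ≤ ε) :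
    IsCondWeakMixing m μ φ f := by
  refine ⟨hf, tendsto_avg_zero_of_approx (corr_nonneg _ _) fun ε hε => ?_⟩
  -- The radius makes the error `‖f - g‖ ‖f‖` at most `ε`; the `+ 1` covers `‖f‖ = 0`.
  obtain ⟨g, hg, hfg⟩ := h ((ε / (√(sqInt μ f) + 1)) ^ 2) (by positivity)
  refine ⟨_, hg.tendsto_corr H hf, fun n => ?_⟩
  have hd : MemLp (fun x => f x - g x) 2 μ := hf.sub hg.1
  have h1 := corr_add_left_le (m := m) H.mp hg.1 hd hf n
  simp only [add_sub_cancel] at h1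
  refine h1.trans (add_le_add_right ((corr_le H.mp hd hf n).trans ?_) _)
  calc √(sqInt μ fun x => f x - g x) * √(sqInt μ f)
      ≤ ε / (√(sqInt μ f) + 1) * (√(sqInt μ f) + 1) := by
        gcongr
        · exact Real.sqrt_le_iff.2 ⟨by positivity, hfg⟩
        · linarith
    _ = ε := by field_simp

theorem IsCondWeakMixing.of_tendsto (H : IsFactorAlgebra m μ φ) {f : X → ℂ} (hf : MemLp f 2 μ)
    {g : ℕ → X → ℂ} (hg : ∀ n, IsCondWeakMixing m μ φ (g n))
    (h : Tendsto (fun n => sqInt μ (fun x => f x - g n x)) atTop (𝓝 0)) :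
    IsCondWeakMixing m μ φ f := by
  refine .of_approx H hf fun ε hε => ?_
  obtain ⟨n, hn⟩ := (h.eventually (eventually_lt_nhds hε)).exists
  exact ⟨g n, hg n, hn.le⟩

theorem IsCondWeakMixing.congr (H : IsFactorAlgebra m μ φ) {f g : X → ℂ}
    (hf : IsCondWeakMixing m μ φ f) (h : f =ᵐ[μ] g) : IsCondWeakMixing m μ φ g := by
  refine .of_approx H ((memLp_congr_ae h).1 hf.1) fun ε hε => ⟨f, hf, ?_⟩
  rw [sqInt_congr (g := fun _ => 0) (by filter_upwards [h] with x hx; simp [hx])]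
  simpa [sqInt] using hε.le

/-- Tested against `h = 1`, every correlation is at least `‖∫ f‖`, a constant whose averages can
tend to zero only if it vanishes. -/
theorem IsCondWeakMixing.integral_eq_zero (H : IsFactorAlgebra m μ φ) {f : X → ℂ}
    (hf : IsCondWeakMixing m μ φ f) : ∫ x, f x ∂μ = 0 := by
  have h1 := hf.tendsto_corr H (h := fun _ => 1) (memLp_const 1)
  have h2 : ∀ n, ‖∫ x, f x ∂μ‖ ≤ corr m μ φ f (fun _ => 1) n := by
    intro n
    rw [← integral_comp_eq (H.mp.iterate n) hf.1.1,
      ← integral_condExp H.le]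
    simp only [corr, map_one, mul_one]
    exact norm_integral_le_integral_norm _
  have h3 := tendsto_avg_zero_of_le (a := fun _ => ‖∫ x, f x ∂μ‖) (fun _ => norm_nonneg _) h2 h1
  have h4 : Tendsto (avg fun _ => ‖∫ x, f x ∂μ‖) atTop (𝓝 ‖∫ x, f x ∂μ‖) := by
    refine tendsto_const_nhds.congr' ?_
    filter_upwards [eventually_ne_atTop 0] with N hN using (avg_const hN _).symm
  exact norm_eq_zero.1 (tendsto_nhds_unique h4 h3)

end WeakMixing

/-! ### Multipliers of weakly mixing functions and their σ-algebra -/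

section Multiplier

variable {X : Type*} {m mX : MeasurableSpace X} {μ : Measure X} {φ : X → X}

theorem tendsto_sqInt_mul {f : X → ℂ} (hf : MemLp f 2 μ) {c : ℕ → X → ℂ}
    (hc : ∀ n, AEStronglyMeasurable (c n) μ) (hc1 : ∀ n x, ‖c n x‖ ≤ 1)
    (h : ∀ x, Tendsto (fun n => c n x) atTop (𝓝 0)) :
    Tendsto (fun n => sqInt μ fun x => c n x * f x) atTop (𝓝 0) := by
  have := tendsto_integral_of_dominated_convergence (μ := μ)
    (F := fun n x => ‖c n x * f x‖ ^ 2) (f := fun _ => 0) (fun x => ‖f x‖ ^ 2)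
    (fun n => ((hc n).mul hf.1).norm.pow 2) (integrable_norm_sq hf) ?_ ?_
  · simpa [sqInt] using this
  · refine fun n => Eventually.of_forall fun x => ?_
    rw [Real.norm_of_nonneg (by positivity), norm_mul]
    gcongr
    exact mul_le_of_le_one_left (norm_nonneg _) (hc1 n x)
  · refine Eventually.of_forall fun x => ?_
    simpa using (((h x).mul_const (f x)).norm.pow 2)

/-- Bounded functions that leave the set of conditionally weakly mixing functions invariant. -/
def IsMultiplier (m : MeasurableSpace X) {mX : MeasurableSpace X} (μ : Measure X) (φ : X → X)
    (a : X → ℂ) : Prop :=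
  MemLp a ∞ μ ∧ ∀ f, IsCondWeakMixing m μ φ f → IsCondWeakMixing m μ φ fun x => a x * f x

theorem IsMultiplier.mul {a b : X → ℂ} (ha : IsMultiplier m μ φ a)
    (hb : IsMultiplier m μ φ b) : IsMultiplier m μ φ fun x => a x * b x :=
  ⟨memLp_top_mul ha.1 hb.1, fun f hf => by
    simpa only [mul_assoc] using ha.2 _ (hb.2 f hf)⟩

theorem IsMultiplier.conj (H : IsFactorAlgebra m μ φ) {a : X → ℂ} (ha : IsMultiplier m μ φ a) :
    IsMultiplier m μ φ fun x => conj (a x) :=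
  ⟨memLp_conj ha.1, fun f hf => by
    simpa only [map_mul, Complex.conj_conj] using (ha.2 _ (hf.conj H)).conj H⟩

variable [IsProbabilityMeasure μ]

/-- The `σ`-algebra of all sets whose indicator functions leave the set of conditionally weakly
mixing functions invariant. -/
@[reducible]
def multiplierAlgebra (H : IsFactorAlgebra m μ φ) : MeasurableSpace X where
  MeasurableSet' B := MeasurableSet[mX] B ∧
    ∀ f, IsCondWeakMixing m μ φ f → IsCondWeakMixing m μ φ (B.indicator f)
  measurableSet_empty := ⟨MeasurableSet.empty, fun f _ => by
    simpa using isCondWeakMixing_zero⟩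
  measurableSet_compl B hB := ⟨hB.1.compl, fun f hf => by
    have := hf.sub H (hB.2 f hf)
    rwa [show (fun x => f x - B.indicator f x) = Bᶜ.indicator f from
      (Set.indicator_compl B f).symm] at this⟩
  measurableSet_iUnion B hB := by
    refine ⟨MeasurableSet.iUnion fun i => (hB i).1, fun f hf => ?_⟩
    have hfin : ∀ n : ℕ, MeasurableSet (⋃ i < n, B i) ∧
        ∀ f, IsCondWeakMixing m μ φ f → IsCondWeakMixing m μ φ ((⋃ i < n, B i).indicator f) := by
      intro n
      induction n with
      | zero => exact ⟨by simp, fun f _ => by simpa using isCondWeakMixing_zero⟩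
      | succ n ih =>
        have e : (⋃ i < n + 1, B i) = (⋃ i < n, B i) ∪ B n := Set.biUnion_lt_succ B n
        rw [e]
        refine ⟨ih.1.union (hB n).1, fun f hf => ?_⟩
        -- Inclusion–exclusion: `1_{A ∪ B} f = 1_A f + 1_B f - 1_A 1_B f`.
        have h1 := ((ih.2 f hf).add H ((hB n).2 f hf)).sub H ((ih.2 _ ((hB n).2 f hf)))
        refine h1.congr H (Eventually.of_forall fun x => ?_)
        by_cases hx : x ∈ ⋃ i < n, B i <;> by_cases hy : x ∈ B n <;>
          simp only [Set.indicator, Set.mem_union, hx, hy] <;> simp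
    have hU : MeasurableSet (⋃ i, B i) := MeasurableSet.iUnion fun i => (hB i).1
    refine .of_tendsto H (hf.1.indicator hU) (fun n => (hfin n).2 f hf) ?_
    have h1 := tendsto_sqInt_mul hf.1
      (c := fun n x => (⋃ i, B i).indicator 1 x - (⋃ i < n, B i).indicator 1 x)
      (fun n => ((measurable_one.indicator hU).sub
        (measurable_one.indicator (hfin n).1)).aestronglyMeasurable) ?_ ?_
    · refine h1.congr fun n => congrArg _ (funext fun x => ?_)
      simp only [sub_mul, Set.indicator, Pi.one_apply]
      split_ifs <;> simp
    · intro n x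
      by_cases h1 : x ∈ ⋃ i, B i <;> by_cases h2 : x ∈ ⋃ i < n, B i <;> simp [Set.indicator, h1, h2]
    · intro x
      by_cases hx : x ∈ ⋃ i, B i
      · obtain ⟨i, hi⟩ := Set.mem_iUnion.1 hx
        refine tendsto_const_nhds.congr' ?_
        filter_upwards [eventually_gt_atTop i] with n hn
        have h2 : x ∈ ⋃ i < n, B i := Set.mem_biUnion (x := i) hn hi
        simp only [Set.indicator_of_mem hx, Set.indicator_of_mem h2, Pi.one_apply, sub_self]
      · have h2 : ∀ n : ℕ, x ∉ ⋃ i < n, B i := fun n h => hx (by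
          obtain ⟨i, -, hi⟩ := Set.mem_iUnion₂.1 h
          exact Set.mem_iUnion.2 ⟨i, hi⟩)
        simp only [Set.indicator_of_notMem hx, Set.indicator_of_notMem (h2 _), sub_self,
          tendsto_const_nhds]

theorem multiplierAlgebra_le (H : IsFactorAlgebra m μ φ) : multiplierAlgebra H ≤ mX :=
  fun _ hB => hB.1

/-- For `B` in the multiplier algebra, `1_B f` is again weakly mixing, so `∫_B f = 0`. -/
theorem IsCondWeakMixing.condExp_multiplierAlgebra (H : IsFactorAlgebra m μ φ) {f : X → ℂ}
    (hf : IsCondWeakMixing m μ φ f) : μ[f | multiplierAlgebra H] =ᵐ[μ] 0 := by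
  refine (ae_eq_condExp_of_forall_setIntegral_eq (multiplierAlgebra_le H)
    (hf.1.integrable (by norm_num)) (fun _ _ _ => (integrable_zero _ _ _).integrableOn)
    (fun B hB _ => ?_) aestronglyMeasurable_const).symm
  have h := (hB.2 f hf).integral_eq_zero H
  rw [integral_indicator hB.1] at h
  simp [h]

theorem isMultiplier_const (H : IsFactorAlgebra m μ φ) (c : ℂ) :
    IsMultiplier m μ φ fun _ => c :=
  ⟨memLp_const c, fun _ hf => hf.const_mul H c⟩

theorem IsMultiplier.add (H : IsFactorAlgebra m μ φ) {a b : X → ℂ} (ha : IsMultiplier m μ φ a)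
    (hb : IsMultiplier m μ φ b) : IsMultiplier m μ φ fun x => a x + b x :=
  ⟨ha.1.add hb.1, fun f hf => by
    simpa only [add_mul] using (ha.2 f hf).add H (hb.2 f hf)⟩

theorem IsMultiplier.polynomial_eval (H : IsFactorAlgebra m μ φ) {b : X → ℝ}
    (hb : IsMultiplier m μ φ fun x => (b x : ℂ)) (p : Polynomial ℝ) :
    IsMultiplier m μ φ fun x => ((p.eval (b x) : ℝ) : ℂ) := by
  induction p using Polynomial.induction_on with
  | C c => simpa using isMultiplier_const H (c : ℂ)
  | add p q hp hq => simpa using hp.add H hq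
  | monomial n c ih =>
    have := ih.mul hb
    simpa [pow_succ, mul_assoc] using this

/-- By Weierstrass, `g` is a uniform limit of polynomials on `[-K, K]`, which contains almost all
values of `b`. Polynomials in `b` are multipliers and `W` is closed. -/
theorem IsMultiplier.continuous_comp (H : IsFactorAlgebra m μ φ) {b : X → ℝ}
    (hb : IsMultiplier m μ φ fun x => (b x : ℂ)) {g : ℝ → ℝ} (hg : Continuous g) {f : X → ℂ}
    (hf : IsCondWeakMixing m μ φ f) (hgf : MemLp (fun x => (g (b x) : ℂ) * f x) 2 μ) :
    IsCondWeakMixing m μ φ fun x => (g (b x) : ℂ) * f x := by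
  obtain ⟨K, hK0, hK⟩ := exists_bound_of_memLp_top hb.1
  refine .of_approx H hgf fun ε hε => ?_
  obtain ⟨p, hp⟩ := exists_polynomial_near_of_continuousOn (-K) K g hg.continuousOn
    (√(ε / (sqInt μ f + 1))) (by have := sqInt_nonneg (μ := μ) f; positivity)
  refine ⟨_, (hb.polynomial_eval H p).2 f hf, ?_⟩
  have h1 := sqInt_mul_le (f := fun x => ((g (b x) - p.eval (b x) : ℝ) : ℂ)) (g := f)
    (C := √(ε / (sqInt μ f + 1))) (μ := μ) ?_ hf.1
  · have h0 := sqInt_nonneg (μ := μ) f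
    rw [Real.sq_sqrt (by positivity)] at h1
    simp only [Complex.ofReal_sub, sub_mul] at h1
    refine h1.trans ?_
    rw [div_mul_eq_mul_div, div_le_iff₀ (by positivity)]
    nlinarith
  · filter_upwards [hK] with x hx
    rw [Complex.norm_real, Real.norm_eq_abs] at hx ⊢
    rw [abs_sub_comm]
    exact (hp _ (abs_le.1 hx)).le

/-- The indicator of `{b > t}` is a pointwise limit of the continuous ramps `min 1 (max 0 (k (b -
t)))`, which map `W` into itself; dominated convergence transfers this to the limit. -/
theorem IsMultiplier.measurable_of_real (H : IsFactorAlgebra m μ φ) {b : X → ℝ}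
    (hbm : Measurable b) (hb : IsMultiplier m μ φ fun x => (b x : ℂ)) :
    Measurable[multiplierAlgebra H] b := by
  refine measurable_of_Ioi fun t => ?_
  refine ⟨hbm measurableSet_Ioi, fun f hf => ?_⟩
  set g : ℕ → ℝ → ℝ := fun k s => min 1 (max 0 (k * (s - t))) with hg
  have hgc : ∀ k, Continuous (g k) := fun k => by fun_prop
  have hg0 : ∀ k s, 0 ≤ g k s := fun k s => le_min zero_le_one (le_max_left _ _)
  have hg1 : ∀ k s, g k s ≤ 1 := fun k s => min_le_left _ _
  have hgm : ∀ k, Measurable fun x => (g k (b x) : ℂ) := fun k =>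
    Complex.measurable_ofReal.comp ((hgc k).measurable.comp hbm)
  have hgT : ∀ k, MemLp (fun x => (g k (b x) : ℂ)) ∞ μ := fun k =>
    memLp_top_of_bound (hgm k).aestronglyMeasurable 1 (Eventually.of_forall fun x => by
      rw [Complex.norm_real, Real.norm_of_nonneg (hg0 _ _)]; exact hg1 _ _)
  have hS : MeasurableSet (b ⁻¹' Set.Ioi t) := hbm measurableSet_Ioi
  refine .of_tendsto H (hf.1.indicator hS)
    (fun k => hb.continuous_comp H (hgc k) hf (memLp_top_mul (hgT k) hf.1)) ?_
  have h1 := tendsto_sqInt_mul hf.1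
    (c := fun k x => (b ⁻¹' Set.Ioi t).indicator 1 x - (g k (b x) : ℂ))
    (fun n => ((measurable_one.indicator hS).sub (hgm n)).aestronglyMeasurable) ?_ ?_
  · refine h1.congr fun n => congrArg _ (funext fun x => ?_)
    simp only [sub_mul, Set.indicator, Pi.one_apply]
    split_ifs <;> simp
  · intro k x
    by_cases hx : x ∈ b ⁻¹' Set.Ioi t
    · rw [Set.indicator_of_mem hx, Pi.one_apply, ← Complex.ofReal_one, ← Complex.ofReal_sub,
        Complex.norm_real, Real.norm_of_nonneg (by linarith [hg1 k (b x)])]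
      linarith [hg0 k (b x)]
    · rw [Set.indicator_of_notMem hx, zero_sub, norm_neg, Complex.norm_real,
        Real.norm_of_nonneg (hg0 _ _)]
      exact hg1 _ _
  · intro x
    by_cases hx : x ∈ b ⁻¹' Set.Ioi t
    · have hx' : 0 < b x - t := sub_pos.2 hx
      obtain ⟨N, hN⟩ := exists_nat_gt (1 / (b x - t))
      refine tendsto_const_nhds.congr' ?_
      filter_upwards [eventually_ge_atTop N] with k hk
      have hk' : (N : ℝ) ≤ k := by exact_mod_cast hk
      have h2 : 1 ≤ k * (b x - t) := by
        rw [div_lt_iff₀ hx'] at hN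
        nlinarith
      rw [Set.indicator_of_mem hx]
      simp only [hg, Pi.one_apply]
      rw [max_eq_right (by linarith), min_eq_left h2]
      simp
    · refine tendsto_const_nhds.congr fun k => ?_
      have hx' : b x - t ≤ 0 := sub_nonpos.2 (not_lt.1 hx)
      rw [Set.indicator_of_notMem hx]
      simp only [hg]
      rw [max_eq_left (mul_nonpos_of_nonneg_of_nonpos (Nat.cast_nonneg _) hx'),
        min_eq_right zero_le_one]
      simp

theorem IsMultiplier.congr (H : IsFactorAlgebra m μ φ) {a b : X → ℂ} (ha : IsMultiplier m μ φ a)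
    (h : a =ᵐ[μ] b) : IsMultiplier m μ φ b :=
  ⟨(memLp_congr_ae h).1 ha.1, fun f hf => (ha.2 f hf).congr H (by
    filter_upwards [h] with x hx; rw [hx])⟩

/-- Multipliers are closed under conjugation, so real and imaginary parts reduce the claim to real
multipliers. This is how the limit kernel function becomes orthogonal to everything with zero
conditional expectation. -/
theorem IsMultiplier.aestronglyMeasurable (H : IsFactorAlgebra m μ φ) {a : X → ℂ}
    (ha : IsMultiplier m μ φ a) : AEStronglyMeasurable[multiplierAlgebra H] a μ := by
  have hm := ha.1.1.stronglyMeasurable_mk.measurable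
  have hb := ha.congr H ha.1.1.ae_eq_mk
  set b := ha.1.1.mk a with hb'
  have hre : IsMultiplier m μ φ fun x => ((b x).re : ℂ) := by
    refine ((isMultiplier_const H (1 / 2)).mul (hb.add H (hb.conj H))).congr H
      (Eventually.of_forall fun x => ?_)
    simp only [Complex.add_conj]
    push_cast; ring
  have him : IsMultiplier m μ φ fun x => ((b x).im : ℂ) := by
    refine ((isMultiplier_const H (1 / (2 * Complex.I))).mul
      (hb.add H ((isMultiplier_const H (-1)).mul (hb.conj H)))).congr H
      (Eventually.of_forall fun x => ?_)
    simp only [neg_mul, one_mul, ← sub_eq_add_neg, Complex.sub_conj]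
    push_cast
    field_simp
  have h1 := hre.measurable_of_real H (Complex.measurable_re.comp hm)
  have h2 := him.measurable_of_real H (Complex.measurable_im.comp hm)
  have h3 : Measurable[multiplierAlgebra H] b := by
    have := (Complex.measurable_ofReal.comp h1).add
      ((Complex.measurable_ofReal.comp h2).mul_const Complex.I)
    convert this using 1
    ext x
    exact (Complex.re_add_im (b x)).symm
  exact ⟨b, h3.stronglyMeasurable, ha.1.1.ae_eq_mk⟩

end Multiplier

/-! ### The mean ergodic theorem in semi-inner product spaces -/

section MeanErgodic

/-- The mean ergodic theorem in a space with a semi-inner product: the ergodic averages are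
uniformly almost invariant. -/
theorem exists_birkhoffAverage_near {E : Type*} [SeminormedAddCommGroup E] [InnerProductSpace ℂ E]
    (U : E →ₗ[ℂ] E) (hU : ∀ x, ‖U x‖ ≤ ‖x‖) (x : E) {ε : ℝ} (hε : 0 < ε) :
    ∃ N₀, ∀ N ≥ N₀, ∀ n, ‖U^[n] (birkhoffAverage ℂ U id N x) - birkhoffAverage ℂ U id N₀ x‖ ≤ ε := by
  -- The von Neumann theorem needs a Hilbert space, so `U` is extended to the completion, where
  -- norms of elements of `E` are unchanged.
  set U' : E →L[ℂ] E := U.mkContinuous 1 (by simpa using hU) with hU'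
  set V := U'.completion with hV
  have hVc : ∀ y : E, V (y : UniformSpace.Completion E) = (U y : E) := fun y => by
    simp [hV, hU']
  have hV1 : ‖V‖ ≤ 1 := by
    refine ContinuousLinearMap.opNorm_le_bound _ zero_le_one fun y => ?_
    refine UniformSpace.Completion.induction_on y
      (isClosed_le (by fun_prop) (by fun_prop)) fun a => ?_
    rw [hVc, UniformSpace.Completion.norm_coe, UniformSpace.Completion.norm_coe, one_mul]
    exact hU a
  have hVn : ∀ (n : ℕ) (y : E), V^[n] (y : UniformSpace.Completion E) = (U^[n] y : E) := by
    intro n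
    induction n with
    | zero => intro y; rfl
    | succ n ih => intro y; rw [Function.iterate_succ_apply, Function.iterate_succ_apply, hVc, ih]
  have hA : ∀ N, birkhoffAverage ℂ V id N (x : UniformSpace.Completion E) =
      (birkhoffAverage ℂ U id N x : E) := by
    intro N
    simp only [birkhoffAverage, birkhoffSum, id, hVn, UniformSpace.Completion.coe_smul]
    congr 1
    exact (map_sum (UniformSpace.Completion.toCompl (α := E)) _ _).symm
  obtain ⟨κ, hκ, hlim⟩ : ∃ κ, V κ = κ ∧ Tendsto
      (birkhoffAverage ℂ V id · (x : UniformSpace.Completion E)) atTop (𝓝 κ) :=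
    have hlim := V.tendsto_birkhoffAverage_orthogonalProjection hV1 (x : UniformSpace.Completion E)
    ⟨_, LinearMap.mem_eqLocus.1 (SetLike.coe_mem _), hlim⟩
  have hκn : ∀ n, V^[n] κ = κ := fun n => Function.iterate_fixed hκ n
  have hVle : ∀ (n : ℕ) (y : UniformSpace.Completion E), ‖V^[n] y‖ ≤ ‖y‖ := by
    intro n
    induction n with
    | zero => intro y; rfl
    | succ n ih =>
      intro y
      rw [Function.iterate_succ_apply]
      exact (ih _).trans (by simpa using V.le_of_opNorm_le hV1 y)
  obtain ⟨N₀, hN₀⟩ := Metric.tendsto_atTop.1 hlim (ε / 2) (half_pos hε)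
  refine ⟨N₀, fun N hN n => ?_⟩
  rw [← UniformSpace.Completion.norm_coe, UniformSpace.Completion.coe_sub, ← hVn, ← hA, ← hA]
  -- The limit `κ` is fixed by `V`, so applying the contraction `V^[n]` does not increase the
  -- distance to `κ`. This gives uniformity in `n`.
  have h1 : V^[n] (birkhoffAverage ℂ V id N (x : UniformSpace.Completion E)) - κ =
      V^[n] (birkhoffAverage ℂ V id N (x : UniformSpace.Completion E) - κ) := by
    conv_lhs => rw [← hκn n]
    exact (iterate_map_sub V n _ _).symm
  have h2 := hN₀ N hN
  have h3 := hN₀ N₀ le_rfl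
  rw [dist_eq_norm] at h2
  rw [dist_comm, dist_eq_norm] at h3
  calc _ = ‖(V^[n] (birkhoffAverage ℂ V id N (x : UniformSpace.Completion E)) - κ) +
        (κ - birkhoffAverage ℂ V id N₀ (x : UniformSpace.Completion E))‖ := by
        rw [sub_add_sub_cancel]
    _ ≤ ‖V^[n] (birkhoffAverage ℂ V id N (x : UniformSpace.Completion E)) - κ‖ +
        ‖κ - birkhoffAverage ℂ V id N₀ (x : UniformSpace.Completion E)‖ := norm_add_le _ _
    _ ≤ ε / 2 + ε / 2 := by
        rw [h1]
        exact add_le_add ((hVle n _).trans h2.le) h3.le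
    _ = ε := by ring

end MeanErgodic

/-! ### Kernels on the relatively independent joining -/

section Kernel

variable {X : Type*} {m mX : MeasurableSpace X} {μ : Measure X} {φ : X → X}

/-- Pairs of bounded functions `(u, v)`, regarded as the elementary kernels
`(x, y) ↦ u x * conj (v y)`. -/
abbrev BddPair (μ : Measure X) :=
  {p : (X → ℂ) × (X → ℂ) // MemLp p.1 ∞ μ ∧ MemLp p.2 ∞ μ}

/-- The conditional inner product `E(u · conj v | m)`. -/
noncomputable def condIn (m : MeasurableSpace X) {mX : MeasurableSpace X} (μ : Measure X)
    (u v : X → ℂ) : X → ℂ := μ[fun y => u y * conj (v y) | m]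

theorem memLp_condIn {u v : X → ℂ} (hu : MemLp u ∞ μ) (hv : MemLp v ∞ μ) :
    MemLp (condIn m μ u v) ∞ μ :=
  (memLp_top_mul hu (memLp_conj hv)).condExp le_top

theorem condIn_self_re_nonneg (u : X → ℂ) : ∀ᵐ x ∂μ, 0 ≤ (condIn m μ u u x).re := by
  by_cases hu : Integrable (fun y => u y * conj (u y)) μ
  · have h1 := ContinuousLinearMap.comp_condExp_comm (m := m) hu Complex.reCLM
    have h2 : 0 ≤ᵐ[μ] μ[Complex.reCLM ∘ (fun y => u y * conj (u y)) | m] :=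
      condExp_nonneg (Eventually.of_forall fun x => by
        simp only [Function.comp_apply, Complex.mul_conj, Complex.reCLM_apply, Complex.ofReal_re]
        exact Complex.normSq_nonneg _)
    filter_upwards [h1, h2] with x h1 h2
    rw [← h1] at h2
    exact h2
  · simp [condIn, condExp_of_not_integrable hu]

/-- The operator defined by a combination of elementary kernels: `(u, v)` maps `g` to
`u · E(g · conj v | m)`. -/
noncomputable def kernelAct (m : MeasurableSpace X) {mX : MeasurableSpace X} (μ : Measure X)
    (g : X → ℂ) : (BddPair μ →₀ ℂ) →ₗ[ℂ] (X → ℂ) :=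
  Finsupp.linearCombination ℂ fun p x => p.1.1 x * condIn m μ g p.1.2 x

theorem kernelAct_apply (g : X → ℂ) (ξ : BddPair μ →₀ ℂ) (x : X) :
    kernelAct m μ g ξ x = ∑ p ∈ ξ.support, ξ p * (p.1.1 x * condIn m μ g p.1.2 x) := by
  simp [kernelAct, Finsupp.linearCombination_apply, Finsupp.sum]

theorem memLp_kernelAct {g : X → ℂ} (hg : MemLp g ∞ μ) (ξ : BddPair μ →₀ ℂ) :
    MemLp (kernelAct m μ g ξ) ∞ μ := by
  have e : kernelAct m μ g ξ = fun x =>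
      ∑ p ∈ ξ.support, ξ p * (p.1.1 x * condIn m μ g p.1.2 x) :=
    funext fun x => kernelAct_apply g ξ x
  rw [e]
  exact memLp_finsetSum _ fun p _ =>
    (memLp_top_mul p.2.1 (memLp_condIn hg p.2.2)).const_mul _

variable [IsFiniteMeasure μ]

theorem integrable_of_memLp_top {f : X → ℂ} (hf : MemLp f ∞ μ) : Integrable f μ :=
  hf.integrable le_top

theorem condIn_conj {u v : X → ℂ} (hu : MemLp u ∞ μ) (hv : MemLp v ∞ μ) :
    (fun x => conj (condIn m μ u v x)) =ᵐ[μ] condIn m μ v u := by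
  have h := condExp_conj (m := m) (integrable_of_memLp_top (memLp_top_mul hu (memLp_conj hv)))
  simp only [map_mul, Complex.conj_conj, mul_comm (conj (u _))] at h
  exact h.symm

/-- Conditional Gram matrices are almost everywhere positive semidefinite. -/
theorem ae_condGram_nonneg {ι : Type*} [Fintype ι] {v : ι → X → ℂ} (hv : ∀ i, MemLp (v i) ∞ μ) :
    ∀ᵐ x ∂μ, ∀ z : ι → ℂ,
      0 ≤ (∑ i, ∑ j, conj (z i) * z j * condIn m μ (v i) (v j) x).re := by
  have h1 : ∀ z : ι → ℂ, ∀ᵐ x ∂μ,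
      0 ≤ (∑ i, ∑ j, conj (z i) * z j * condIn m μ (v i) (v j) x).re := by
    intro z
    have hi : ∀ i j, Integrable (fun x => (conj (z i) * z j) • (v i x * conj (v j x))) μ :=
      fun i j => (integrable_of_memLp_top (memLp_top_mul (hv i) (memLp_conj (hv j)))).const_mul _
    have e : (fun x => (∑ i, conj (z i) * v i x) * conj (∑ i, conj (z i) * v i x)) =
        ∑ i, ∑ j, fun x => (conj (z i) * z j) • (v i x * conj (v j x)) := by
      ext x
      simp only [Finset.sum_apply, map_sum, Finset.sum_mul_sum, map_mul, Complex.conj_conj,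
        smul_eq_mul]
      exact Finset.sum_congr rfl fun i _ => Finset.sum_congr rfl fun j _ => by ring
    have h2 : ∀ i, μ[∑ j, fun x => (conj (z i) * z j) • (v i x * conj (v j x)) | m] =ᵐ[μ]
        ∑ j, fun x => (conj (z i) * z j) * condIn m μ (v i) (v j) x := fun i =>
      (condExp_finsetSum (fun j _ => hi i j) m).trans
        (eventuallyEq_sum fun j _ => condExp_const_mul _)
    have h3 := (condExp_finsetSum (fun i (_ : i ∈ Finset.univ) =>
      integrable_finsetSum' Finset.univ fun j _ => hi i j) m).trans
        (eventuallyEq_sum fun i _ => h2 i)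
    rw [← e] at h3
    filter_upwards [condIn_self_re_nonneg (m := m) (μ := μ) (fun x => ∑ i, conj (z i) * v i x), h3]
      with x h4 h5
    rw [condIn, h5] at h4
    simpa only [Finset.sum_apply] using h4
  -- For each fixed `z` the exceptional null set depends on `z`. A countable dense set of `z` gives
  -- one null set, and continuity of the quadratic form in `z` extends the inequality.
  have h2 : ∀ᵐ x ∂μ, ∀ k : ℕ, 0 ≤ (∑ i, ∑ j,
      conj (TopologicalSpace.denseSeq (ι → ℂ) k i) * TopologicalSpace.denseSeq (ι → ℂ) k j *
        condIn m μ (v i) (v j) x).re := ae_all_iff.2 fun k => h1 _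
  filter_upwards [h2] with x hx z
  have hcl : IsClosed {z : ι → ℂ |
      0 ≤ (∑ i, ∑ j, conj (z i) * z j * condIn m μ (v i) (v j) x).re} := by
    refine isClosed_le continuous_const (Complex.continuous_re.comp ?_)
    refine continuous_finsetSum _ fun i _ => continuous_finsetSum _ fun j _ => ?_
    exact (((Complex.continuous_conj.comp (continuous_apply i))).mul
      (continuous_apply j)).mul continuous_const
  have := hcl.closure_subset_iff.2 (Set.range_subset_iff.2 hx)
  rw [(TopologicalSpace.denseRange_denseSeq (ι → ℂ)).closure_range] at this
  exact this (Set.mem_univ z)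

/-- The inner product of two elementary kernels in the relatively independent joining. -/
noncomputable def pairInner (m : MeasurableSpace X) {mX : MeasurableSpace X} (μ : Measure X)
    (p q : BddPair μ) : ℂ :=
  ∫ x, conj (p.1.1 x) * q.1.1 x * condIn m μ p.1.2 q.1.2 x ∂μ

theorem integrable_pairInner (p q : BddPair μ) :
    Integrable (fun x => conj (p.1.1 x) * q.1.1 x * condIn m μ p.1.2 q.1.2 x) μ :=
  integrable_of_memLp_top (memLp_top_mul (memLp_top_mul (memLp_conj p.2.1) q.2.1)
    (memLp_condIn p.2.2 q.2.2))

theorem pairInner_conj (p q : BddPair μ) : conj (pairInner m μ q p) = pairInner m μ p q := by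
  rw [pairInner, ← integral_conj]
  refine integral_congr_ae ?_
  filter_upwards [condIn_conj (m := m) q.2.2 p.2.2] with x hx
  simp only [map_mul, Complex.conj_conj, hx]
  ring

theorem pairInner_nonneg (s : Finset (BddPair μ)) (a : BddPair μ → ℂ) :
    0 ≤ (∑ p ∈ s, ∑ q ∈ s, conj (a p) * a q * pairInner m μ p q).re := by
  have e : ∑ p ∈ s, ∑ q ∈ s, conj (a p) * a q * pairInner m μ p q =
      ∫ x, ∑ p ∈ s, ∑ q ∈ s, conj (a p * p.1.1 x) * (a q * q.1.1 x) *
        condIn m μ p.1.2 q.1.2 x ∂μ := by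
    have hi : ∀ p q : BddPair μ, Integrable (fun x => conj (a p * p.1.1 x) * (a q * q.1.1 x) *
        condIn m μ p.1.2 q.1.2 x) μ := fun p q =>
      ((integrable_pairInner (m := m) p q).const_mul (conj (a p) * a q)).congr
        (Eventually.of_forall fun x => by simp only [map_mul]; ring)
    rw [integral_finsetSum _ fun p _ => integrable_finsetSum _ fun q _ => hi p q]
    refine Finset.sum_congr rfl fun p _ => ?_
    rw [integral_finsetSum _ fun q _ => hi p q]
    refine Finset.sum_congr rfl fun q _ => ?_
    rw [pairInner, ← integral_const_mul]
    exact integral_congr_ae (Eventually.of_forall fun x => by simp only [map_mul]; ring)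
  have hi : Integrable (fun x => ∑ p ∈ s, ∑ q ∈ s, conj (a p * p.1.1 x) * (a q * q.1.1 x) *
        condIn m μ p.1.2 q.1.2 x) μ := by
    refine integrable_finsetSum _ fun p _ => integrable_finsetSum _ fun q _ => ?_
    exact ((integrable_pairInner (m := m) p q).const_mul (conj (a p) * a q)).congr
        (Eventually.of_forall fun x => by simp only [map_mul]; ring)
  rw [e]
  have h2 : (∫ x, ∑ p ∈ s, ∑ q ∈ s, conj (a p * p.1.1 x) * (a q * q.1.1 x) *
        condIn m μ p.1.2 q.1.2 x ∂μ).re = ∫ x, (∑ p ∈ s, ∑ q ∈ s, conj (a p * p.1.1 x) *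
          (a q * q.1.1 x) * condIn m μ p.1.2 q.1.2 x).re ∂μ := (integral_re hi).symm
  rw [h2]
  refine integral_nonneg_of_ae ?_
  filter_upwards [ae_condGram_nonneg (m := m) (ι := s) (v := fun p => p.1.1.2)
    fun p => p.1.2.2] with x hx
  -- The first components of the pairs are absorbed into the coefficients at `x`. The coefficients
  -- then vary with `x`, so one null set had to serve all of them.
  have := hx fun p => a p * p.1.1.1 x
  simp only [Pi.zero_apply]
  rw [← Finset.sum_coe_sort s]
  simp only [← Finset.sum_coe_sort s fun q => _]
  exact this

/-- The semi-inner product on finite combinations of elementary kernels. -/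
noncomputable def kernelInner (m : MeasurableSpace X) {mX : MeasurableSpace X} (μ : Measure X)
    (ξ η : BddPair μ →₀ ℂ) : ℂ :=
  ξ.sum fun p a => η.sum fun q b => conj a * b * pairInner m μ p q

/-- The semi-inner product space of finite combinations of elementary kernels. -/
@[reducible]
noncomputable def kernelCore (m : MeasurableSpace X) {mX : MeasurableSpace X} (μ : Measure X)
    [IsFiniteMeasure μ] : PreInnerProductSpace.Core ℂ (BddPair μ →₀ ℂ) where
  inner := kernelInner m μ
  conj_inner_symm ξ η := by
    simp only [kernelInner, Finsupp.sum, map_sum, map_mul, pairInner_conj, Complex.conj_conj]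
    rw [Finset.sum_comm]
    exact Finset.sum_congr rfl fun p _ => Finset.sum_congr rfl fun q _ => by ring
  re_inner_nonneg ξ := pairInner_nonneg ξ.support ξ
  add_left ξ η ζ := by
    refine Finsupp.sum_add_index' (fun p => by simp) fun p a b => ?_
    simp only [map_add, add_mul, Finsupp.sum_add]
  smul_left ξ η r := by
    simp only [kernelInner]
    rw [Finsupp.sum_smul_index' fun p => by simp, Finsupp.mul_sum]
    refine Finsupp.sum_congr fun p _ => ?_
    rw [Finsupp.mul_sum]
    refine Finsupp.sum_congr fun q _ => ?_
    simp only [smul_eq_mul, map_mul]; ring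

theorem kernelInner_self_nonneg (ξ : BddPair μ →₀ ℂ) : 0 ≤ (kernelInner m μ ξ ξ).re :=
  (kernelCore m μ).re_inner_nonneg ξ

theorem kernelInner_norm_sq_le (ξ η : BddPair μ →₀ ℂ) :
    ‖kernelInner m μ ξ η‖ ^ 2 ≤ (kernelInner m μ ξ ξ).re * (kernelInner m μ η η).re := by
  let := kernelCore m μ
  have h := InnerProductSpace.Core.inner_mul_inner_self_le (𝕜 := ℂ) ξ η
  have h2 : ‖kernelInner m μ η ξ‖ = ‖kernelInner m μ ξ η‖ := by
    rw [← RCLike.norm_conj (kernelInner m μ η ξ)]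
    exact congrArg norm ((kernelCore m μ).conj_inner_symm ξ η)
  change ‖kernelInner m μ ξ η‖ * ‖kernelInner m μ η ξ‖ ≤ _ at h
  rw [h2, ← sq] at h
  exact h

/-- Pairing with an elementary kernel `(u, v)` is the same as applying the operator to `v` and
integrating against `conj u`. This links the semi-inner product to the action. -/
theorem kernelInner_single (p : BddPair μ) (ξ : BddPair μ →₀ ℂ) :
    kernelInner m μ (Finsupp.single p 1) ξ =
      ∫ x, conj (p.1.1 x) * kernelAct m μ p.1.2 ξ x ∂μ := by
  simp only [kernelAct_apply, Finset.mul_sum]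
  rw [kernelInner, Finsupp.sum_single_index (by simp), integral_finsetSum]
  · refine Finset.sum_congr rfl fun q _ => ?_
    simp only [map_one, one_mul, pairInner]
    rw [← integral_const_mul]
    exact integral_congr_ae (Eventually.of_forall fun x => by ring)
  · intro q _
    exact ((integrable_pairInner (m := m) p q).const_mul (ξ q)).congr
      (Eventually.of_forall fun x => by ring)

/-- A Hilbert–Schmidt bound: with `G` the image of `g`, pairing the kernel with the elementary
kernel `(G, g)` gives `‖G‖²`, and that elementary kernel has squared norm at most `C² ‖G‖²`.
Cauchy–Schwarz finishes, after dividing by `‖G‖²` when it is nonzero. -/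
theorem sqInt_kernelAct_le {g : X → ℂ} (hg : MemLp g ∞ μ) {C : ℝ}
    (hgC : ∀ᵐ x ∂μ, ‖g x‖ ≤ C) (ξ : BddPair μ →₀ ℂ) :
    sqInt μ (kernelAct m μ g ξ) ≤ C ^ 2 * (kernelInner m μ ξ ξ).re := by
  set G := kernelAct m μ g ξ with hG
  have hGm : MemLp G ∞ μ := memLp_kernelAct hg ξ
  have hG2 : MemLp G 2 μ := hGm.mono_exponent le_top
  set p : BddPair μ := ⟨(G, g), hGm, hg⟩ with hp
  have h1 : kernelInner m μ (Finsupp.single p 1) ξ = (sqInt μ G : ℂ) := by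
    rw [kernelInner_single, sqInt, ← integral_complex_ofReal]
    refine integral_congr_ae (Eventually.of_forall fun x => ?_)
    simp only [hp, ← hG, Complex.conj_mul', Complex.ofReal_pow]
  have h2 : (kernelInner m μ (Finsupp.single p 1) (Finsupp.single p 1)).re ≤
      C ^ 2 * sqInt μ G := by
    rw [kernelInner, Finsupp.sum_single_index (by simp), Finsupp.sum_single_index (by simp)]
    simp only [map_one, one_mul]
    refine (Complex.re_le_norm _).trans ?_
    rw [sqInt, ← integral_const_mul]
    refine norm_integral_le_of_norm_le ((integrable_norm_sq hG2).const_mul _) ?_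
    have h3 : ∀ᵐ x ∂μ, ‖g x * conj (g x)‖ ≤ C ^ 2 := by
      filter_upwards [hgC] with x hx
      rw [norm_mul, RCLike.norm_conj, ← sq]
      gcongr
    filter_upwards [ae_bdd_norm_condExp_of_ae_bdd_norm (m := m) h3] with x hx
    simp only [hp, norm_mul, RCLike.norm_conj]
    rw [← sq, mul_comm]
    exact mul_le_mul_of_nonneg_right hx (by positivity)
  have h4 := kernelInner_norm_sq_le (m := m) (Finsupp.single p 1) ξ
  rw [h1, Complex.norm_real, Real.norm_of_nonneg (sqInt_nonneg _)] at h4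
  have h5 := kernelInner_self_nonneg (m := m) ξ
  rcases (sqInt_nonneg (μ := μ) G).eq_or_lt with h0 | h0
  · rw [← h0]; positivity
  · have h6 : sqInt μ G * sqInt μ G ≤ sqInt μ G * (C ^ 2 * (kernelInner m μ ξ ξ).re) := by
      nlinarith [mul_le_mul_of_nonneg_right h2 h5]
    exact le_of_mul_le_mul_left h6 h0

/-- The action of a measure-preserving map on elementary kernels. -/
def pairShift (hφ : MeasurePreserving φ μ μ) (p : BddPair μ) : BddPair μ :=
  ⟨(fun x => p.1.1 (φ x), fun x => p.1.2 (φ x)), memLp_comp hφ p.2.1, memLp_comp hφ p.2.2⟩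

/-- The linear action of a measure-preserving map on combinations of elementary kernels. -/
noncomputable def kernelShift (hφ : MeasurePreserving φ μ μ) :
    (BddPair μ →₀ ℂ) →ₗ[ℂ] (BddPair μ →₀ ℂ) :=
  Finsupp.lmapDomain ℂ ℂ (pairShift hφ)

theorem IsFactorAlgebra.condIn_comp (H : IsFactorAlgebra m μ φ) {u v : X → ℂ}
    (hu : MemLp u ∞ μ) (hv : MemLp v ∞ μ) :
    condIn m μ (fun x => u (φ x)) (fun x => v (φ x)) =ᵐ[μ] fun x => condIn m μ u v (φ x) :=
  H.condExp_comp _ (integrable_of_memLp_top (memLp_top_mul hu (memLp_conj hv)))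

theorem IsFactorAlgebra.pairInner_shift (H : IsFactorAlgebra m μ φ) (p q : BddPair μ) :
    pairInner m μ (pairShift H.mp p) (pairShift H.mp q) = pairInner m μ p q := by
  rw [pairInner, pairInner,
    ← integral_comp_eq H.mp (integrable_pairInner p q).aestronglyMeasurable]
  refine integral_congr_ae ?_
  filter_upwards [H.condIn_comp p.2.2 q.2.2] with x hx
  simp only [pairShift, hx]

theorem IsFactorAlgebra.kernelInner_shift (H : IsFactorAlgebra m μ φ) (ξ η : BddPair μ →₀ ℂ) :
    kernelInner m μ (kernelShift H.mp ξ) (kernelShift H.mp η) = kernelInner m μ ξ η := by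
  simp only [kernelInner, kernelShift, Finsupp.lmapDomain_apply]
  rw [Finsupp.sum_mapDomain_index (by simp) fun p a b => by
    simp only [map_add, add_mul, Finsupp.sum_add]]
  refine Finsupp.sum_congr fun p _ => ?_
  rw [Finsupp.sum_mapDomain_index (by simp) fun p a b => by ring]
  simp only [H.pairInner_shift]

/-- Equivariance: shifting both the kernel and the argument shifts the result, because conditional
expectations onto the factor commute with `φ`. -/
theorem IsFactorAlgebra.kernelAct_shift (H : IsFactorAlgebra m μ φ) {g : X → ℂ}
    (hg : MemLp g ∞ μ) (ξ : BddPair μ →₀ ℂ) :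
    kernelAct m μ (fun x => g (φ x)) (kernelShift H.mp ξ) =ᵐ[μ]
      fun x => kernelAct m μ g ξ (φ x) := by
  have h : ∀ᵐ x ∂μ, ∀ p ∈ ξ.support,
      condIn m μ (fun x => g (φ x)) (pairShift H.mp p).1.2 x = condIn m μ g p.1.2 (φ x) :=
    (ξ.support.eventually_all).2 fun p _ => H.condIn_comp hg p.2.2
  filter_upwards [h] with x hx
  rw [kernelAct, kernelAct, kernelShift, Finsupp.lmapDomain_apply,
    Finsupp.linearCombination_mapDomain]
  simp only [Finsupp.linearCombination_apply, Finsupp.sum, Finset.sum_apply, Pi.smul_apply,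
    smul_eq_mul, Function.comp_apply]
  refine Finset.sum_congr rfl fun p hp => ?_
  rw [hx p hp]
  rfl

theorem IsFactorAlgebra.kernelAct_iterate (H : IsFactorAlgebra m μ φ) {g : X → ℂ}
    (hg : MemLp g ∞ μ) (ξ : BddPair μ →₀ ℂ) (n : ℕ) :
    kernelAct m μ (fun x => g (φ^[n] x)) ((kernelShift H.mp)^[n] ξ) =ᵐ[μ]
      fun x => kernelAct m μ g ξ (φ^[n] x) := by
  induction n with
  | zero => rfl
  | succ n ih =>
    have h1 := H.kernelAct_shift (memLp_comp (H.mp.iterate n) hg) ((kernelShift H.mp)^[n] ξ)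
    have h2 := H.mp.quasiMeasurePreserving.ae ih
    filter_upwards [h1, h2] with x h1 h2
    rw [Function.iterate_succ_apply']
    simp only [Function.iterate_succ_apply]
    rw [h1, h2]

/-- The mean ergodic theorem for combinations of elementary kernels. -/
theorem IsFactorAlgebra.exists_kernel_near (H : IsFactorAlgebra m μ φ) (ξ : BddPair μ →₀ ℂ)
    {ε : ℝ} (hε : 0 < ε) :
    ∃ N₀, ∀ N ≥ N₀, ∀ n, ∀ η, η = (kernelShift H.mp)^[n]
      (birkhoffAverage ℂ (kernelShift H.mp) id N ξ) -
        birkhoffAverage ℂ (kernelShift H.mp) id N₀ ξ → (kernelInner m μ η η).re ≤ ε := by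
  let c := kernelCore m μ
  let := InnerProductSpace.Core.toSeminormedAddCommGroup (𝕜 := ℂ) (F := BddPair μ →₀ ℂ)
  let : InnerProductSpace ℂ (BddPair μ →₀ ℂ) := InnerProductSpace.ofCore c
  have hn : ∀ η : BddPair μ →₀ ℂ, ‖η‖ = √((kernelInner m μ η η).re) := fun η => rfl
  obtain ⟨N₀, hN₀⟩ := exists_birkhoffAverage_near (kernelShift H.mp)
    (fun η => by rw [hn, hn, H.kernelInner_shift]) ξ (Real.sqrt_pos.2 hε)
  refine ⟨N₀, fun N hN n η hη => ?_⟩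
  have h := hN₀ N hN n
  rw [← hη, hn] at h
  exact (Real.sqrt_le_sqrt_iff hε.le).1 h

end Kernel

/-! ### Kernel approximation produces multipliers -/

section Approximation

variable {X : Type*} {m mX : MeasurableSpace X} {μ : Measure X} {φ : X → X}

theorem exists_tendsto_of_sqInt_cauchy {g : ℕ → X → ℂ} (hg : ∀ n, MemLp (g n) 2 μ)
    (hC : ∀ ε > 0, ∃ N₀, ∀ N ≥ N₀, sqInt μ (fun x => g N x - g N₀ x) ≤ ε) :
    ∃ a, MemLp a 2 μ ∧ Tendsto (fun n => sqInt μ fun x => a x - g n x) atTop (𝓝 0) := by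
  set u : ℕ → Lp ℂ 2 μ := fun n => (hg n).toLp with hu
  have hnorm : ∀ (f : X → ℂ) (hf : MemLp f 2 μ), ‖hf.toLp‖ ^ 2 = sqInt μ f := fun f hf => by
    rw [Lp.norm_toLp, sqInt_eq_toReal hf]
  have hcau : CauchySeq u := by
    rw [Metric.cauchySeq_iff']
    intro ε hε
    obtain ⟨N₀, hN₀⟩ := hC ((ε / 2) ^ 2) (by positivity)
    refine ⟨N₀, fun N hN => ?_⟩
    have h1 := hN₀ N hN
    have h2 : ‖u N - u N₀‖ ^ 2 = sqInt μ (fun x => g N x - g N₀ x) := by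
      rw [hu, ← MemLp.toLp_sub, hnorm]
      rfl
    rw [← h2] at h1
    have h3 := (sq_le_sq₀ (norm_nonneg _) (half_pos hε).le).1 h1
    rw [dist_eq_norm]
    linarith
  obtain ⟨a, ha⟩ := cauchySeq_tendsto_of_complete hcau
  refine ⟨a, Lp.memLp a, ?_⟩
  have h1 : Tendsto (fun n => ‖u n - a‖ ^ 2) atTop (𝓝 0) := by
    simpa using (tendsto_iff_norm_sub_tendsto_zero.1 ha).pow 2
  refine h1.congr fun n => ?_
  have h2 := hnorm _ ((Lp.memLp a).sub (hg n))
  rw [MemLp.toLp_sub (Lp.memLp a) (hg n), Lp.toLp_coeFn] at h2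
  rw [norm_sub_rev]
  exact h2

/-- The excess `max (‖a‖ - C) 0` is pointwise at most `‖a - g n‖`, so its L²-norm is zero. -/
theorem ae_norm_le_of_tendsto {a : X → ℂ} (ha : MemLp a 2 μ) {g : ℕ → X → ℂ}
    (hg : ∀ n, MemLp (g n) 2 μ) {C : ℝ} (hgC : ∀ n, ∀ᵐ x ∂μ, ‖g n x‖ ≤ C)
    (h : Tendsto (fun n => sqInt μ fun x => a x - g n x) atTop (𝓝 0)) :
    ∀ᵐ x ∂μ, ‖a x‖ ≤ C := by
  have hle : ∀ n, ∀ᵐ x ∂μ, (max (‖a x‖ - C) 0) ^ 2 ≤ ‖a x - g n x‖ ^ 2 := fun n => by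
    filter_upwards [hgC n] with x hx
    have := norm_sub_norm_le (a x) (g n x)
    have h2 : max (‖a x‖ - C) 0 ≤ ‖a x - g n x‖ := max_le (by linarith) (norm_nonneg _)
    gcongr
  have hint : Integrable (fun x => (max (‖a x‖ - C) 0) ^ 2) μ := by
    refine (integrable_norm_sq (ha.sub (hg 0))).mono' ?_ ?_
    · exact (((ha.1.norm.sub aestronglyMeasurable_const).sup aestronglyMeasurable_const).pow 2)
    · filter_upwards [hle 0] with x hx
      rw [Real.norm_of_nonneg (sq_nonneg _)]
      exact hx
  have h0 : ∫ x, (max (‖a x‖ - C) 0) ^ 2 ∂μ = 0 := by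
    refine le_antisymm (ge_of_tendsto' h fun n => ?_) (integral_nonneg fun _ => sq_nonneg _)
    exact integral_mono_ae hint (integrable_norm_sq (ha.sub (hg n))) (hle n)
  rw [integral_eq_zero_iff_of_nonneg (fun _ => sq_nonneg _) hint] at h0
  filter_upwards [h0] with x hx
  have h1 : max (‖a x‖ - C) 0 = 0 := by simpa using hx
  have := le_max_left (‖a x‖ - C) 0
  linarith

theorem integral_norm_condExp_sum_le {ι : Type*} (s : Finset ι) {g : ι → X → ℂ}
    (hg : ∀ i ∈ s, Integrable (g i) μ) :
    ∫ x, ‖(μ[fun x => ∑ i ∈ s, g i x | m]) x‖ ∂μ ≤ ∑ i ∈ s, ∫ x, ‖(μ[g i | m]) x‖ ∂μ := by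
  classical
  induction s using Finset.induction_on with
  | empty =>
    have h0 : (μ[fun _ : X => (0 : ℂ) | m]) = 0 := condExp_zero
    simp [h0]
  | insert i s hi ih =>
    simp only [Finset.sum_insert hi]
    exact (integral_norm_condExp_add_le (hg i (by simp))
      (integrable_finsetSum _ fun j hj => hg j (by simp [hj]))).trans
      (add_le_add_right (ih fun j hj => hg j (by simp [hj])) _)

theorem condIn_norm_le {u v : X → ℂ} {C D : ℝ} (hC : 0 ≤ C) (hu : ∀ᵐ x ∂μ, ‖u x‖ ≤ C)
    (hv : ∀ᵐ x ∂μ, ‖v x‖ ≤ D) : ∀ᵐ x ∂μ, ‖condIn m μ u v x‖ ≤ C * D := by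
  refine ae_bdd_norm_condExp_of_ae_bdd_norm ?_
  filter_upwards [hu, hv] with x h1 h2
  rw [norm_mul, RCLike.norm_conj]
  gcongr

theorem ae_comp_iterate (hφ : MeasurePreserving φ μ μ) {p : X → Prop} (h : ∀ᵐ x ∂μ, p x) (n : ℕ) :
    ∀ᵐ x ∂μ, p (φ^[n] x) :=
  (hφ.iterate n).quasiMeasurePreserving.ae h

variable [IsProbabilityMeasure μ]

/-- The correlations of a kernel applied to a bounded orbit, multiplied by a conditionally weakly
mixing function, vanish on average. -/
theorem exists_bound_kernelAct_corr (H : IsFactorAlgebra m μ φ) {b f h : X → ℂ}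
    (hb : MemLp b ∞ μ) (hf : IsCondWeakMixing m μ φ f) (hh : MemLp h ∞ μ)
    (ξ : BddPair μ →₀ ℂ) :
    ∃ r : ℕ → ℝ, Tendsto (avg r) atTop (𝓝 0) ∧ ∀ n,
      ∫ x, ‖(μ[fun x => kernelAct m μ (fun x => b (φ^[n] x)) ξ x *
        (f (φ^[n] x) * conj (h x)) | m]) x‖ ∂μ ≤ r n := by
  obtain ⟨B, hB0, hB⟩ := exists_bound_of_memLp_top hb
  have hD : ∀ p : BddPair μ, ∃ D : ℝ, 0 ≤ D ∧ ∀ᵐ x ∂μ, ‖p.1.2 x‖ ≤ D :=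
    fun p => exists_bound_of_memLp_top p.2.2
  choose D hD0 hD using hD
  have hph : ∀ p : BddPair μ, MemLp (fun x => conj (p.1.1 x) * h x) 2 μ := fun p =>
    (memLp_top_mul (memLp_conj p.2.1) hh).mono_exponent le_top
  -- For each pair `(u, v)` the factor `E(b ∘ φⁿ · conj v | m)` is `m`-measurable and bounded by `B
  -- * D p` uniformly in `n`, so it comes out of the conditional expectation. The factor `u` is
  -- moved onto `h`, leaving a correlation of `f`.
  refine ⟨fun n => ∑ p ∈ ξ.support, (‖ξ p‖ * (B * D p)) *
    corr m μ φ f (fun x => conj (p.1.1 x) * h x) n, tendsto_avg_zero_sum _ fun p _ =>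
      tendsto_avg_zero_const_mul _ (hf.tendsto_corr H (hph p)), fun n => ?_⟩
  have hbn : MemLp (fun x => b (φ^[n] x)) ∞ μ := memLp_comp (H.mp.iterate n) hb
  have hci : ∀ p : BddPair μ, MemLp (condIn m μ (fun x => b (φ^[n] x)) p.1.2) ∞ μ := fun p =>
    memLp_condIn hbn p.2.2
  have hi1 : ∀ p : BddPair μ, Integrable
      (fun x => f (φ^[n] x) * conj (conj (p.1.1 x) * h x)) μ :=
    fun p => integrable_corr H.mp hf.1 (hph p) n
  have hcT : ∀ p : BddPair μ, MemLp (fun x => ξ p * condIn m μ (fun x => b (φ^[n] x)) p.1.2 x) ∞ μ :=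
    fun p => (hci p).const_mul _
  have hi2 : ∀ p : BddPair μ, Integrable (fun x =>
      (ξ p * condIn m μ (fun x => b (φ^[n] x)) p.1.2 x) *
        (f (φ^[n] x) * conj (conj (p.1.1 x) * h x))) μ := fun p =>
    memLp_one_iff_integrable.1 (memLp_top_mul (hcT p) (memLp_one_iff_integrable.2 (hi1 p)))
  have e : (fun x => kernelAct m μ (fun x => b (φ^[n] x)) ξ x * (f (φ^[n] x) * conj (h x))) =
      fun x => ∑ p ∈ ξ.support, (ξ p * condIn m μ (fun x => b (φ^[n] x)) p.1.2 x) *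
        (f (φ^[n] x) * conj (conj (p.1.1 x) * h x)) := by
    ext x
    rw [kernelAct_apply, Finset.sum_mul]
    refine Finset.sum_congr rfl fun p _ => ?_
    simp only [map_mul, Complex.conj_conj]
    ring
  rw [e]
  refine (integral_norm_condExp_sum_le _ fun p _ => hi2 p).trans (Finset.sum_le_sum fun p _ => ?_)
  rw [corr, ← integral_const_mul]
  refine integral_mono_ae integrable_condExp.norm (integrable_condExp.norm.const_mul _) ?_
  have hm : AEStronglyMeasurable[m]
      (fun x => ξ p * condIn m μ (fun x => b (φ^[n] x)) p.1.2 x) μ :=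
    (stronglyMeasurable_condExp.const_mul (ξ p)).aestronglyMeasurable
  filter_upwards [condExp_mul_left hm (hi2 p) (hi1 p),
    condIn_norm_le (m := m) hB0 (ae_comp_iterate H.mp hB n) (hD p)] with x h1 h2
  rw [h1, norm_mul, norm_mul]
  gcongr

/-- A bounded function whose orbit is uniformly approximated by a kernel acting on a bounded
orbit is a multiplier of the conditionally weakly mixing functions. -/
theorem isMultiplier_of_kernel_approx (H : IsFactorAlgebra m μ φ) {a b : X → ℂ}
    (ha : MemLp a ∞ μ) (hb : MemLp b ∞ μ)
    (h : ∀ ε > 0, ∃ ξ : BddPair μ →₀ ℂ, ∀ n, sqInt μ (fun x => a (φ^[n] x) -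
      kernelAct m μ (fun x => b (φ^[n] x)) ξ x) ≤ ε) : IsMultiplier m μ φ a := by
  refine ⟨ha, fun f hf => ?_⟩
  have haf : MemLp (fun x => a x * f x) 2 μ := memLp_top_mul ha hf.1
  -- Test functions are first taken bounded: the error in the approximation of `a ∘ φⁿ` is small
  -- only in L², so it must be paired with a product `f ∘ φⁿ · conj k` that lies in L².
  have key : ∀ k : X → ℂ, MemLp k ∞ μ →
      Tendsto (avg (corr m μ φ (fun x => a x * f x) k)) atTop (𝓝 0) := by
    intro k hk
    obtain ⟨K, hK0, hK⟩ := exists_bound_of_memLp_top hk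
    refine tendsto_avg_zero_of_approx (corr_nonneg _ _) fun ε hε => ?_
    have hs0 : 0 ≤ √(sqInt μ f) := Real.sqrt_nonneg _
    obtain ⟨ξ, hξ⟩ := h ((ε / (K * √(sqInt μ f) + 1)) ^ 2) (by positivity)
    obtain ⟨r, hr, hle⟩ := exists_bound_kernelAct_corr H hb hf hk ξ
    refine ⟨r, hr, fun n => ?_⟩
    set c := kernelAct m μ (fun x => b (φ^[n] x)) ξ with hc
    have hcT : MemLp c ∞ μ := memLp_kernelAct (memLp_comp (H.mp.iterate n) hb) ξ
    have hdT : MemLp (fun x => a (φ^[n] x) - c x) ∞ μ :=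
      (memLp_comp (H.mp.iterate n) ha).sub hcT
    have hd2 : MemLp (fun x => a (φ^[n] x) - c x) 2 μ := hdT.mono_exponent le_top
    have hfk : MemLp (fun x => f (φ^[n] x) * conj (k x)) 2 μ := by
      simpa only [mul_comm] using
        memLp_top_mul (memLp_conj hk) (memLp_comp (H.mp.iterate n) hf.1)
    have hc2 : MemLp c 2 μ := hcT.mono_exponent le_top
    have h1 := integral_norm_condExp_add_le (m := m) (integrable_mul_two hc2 hfk)
      (integrable_mul_two hd2 hfk)
    have e : (fun x => c x * (f (φ^[n] x) * conj (k x)) +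
        (a (φ^[n] x) - c x) * (f (φ^[n] x) * conj (k x))) =
        fun x => (a (φ^[n] x) * f (φ^[n] x)) * conj (k x) := by ext x; ring
    rw [e] at h1
    refine h1.trans (add_le_add (hle n) ((integral_norm_condExp_le _).trans ?_))
    simp only [norm_mul (_ - _)]
    refine (integral_norm_mul_le hd2 hfk).trans ?_
    have h2 : sqInt μ (fun x => f (φ^[n] x) * conj (k x)) ≤ K ^ 2 * sqInt μ f := by
      have := sqInt_mul_le (f := fun x => conj (k x)) (g := fun x => f (φ^[n] x)) (C := K) (μ := μ)
        (by filter_upwards [hK] with x hx; rwa [RCLike.norm_conj])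
        (memLp_comp (H.mp.iterate n) hf.1)
      rw [sqInt_comp (H.mp.iterate n) hf.1] at this
      simpa only [mul_comm] using this
    calc _ ≤ ε / (K * √(sqInt μ f) + 1) * (K * √(sqInt μ f)) := by
          gcongr
          · exact Real.sqrt_le_iff.2 ⟨by positivity, hξ n⟩
          · rw [Real.sqrt_le_iff]
            refine ⟨by positivity, h2.trans_eq ?_⟩
            rw [mul_pow, Real.sq_sqrt (sqInt_nonneg _)]
      _ ≤ ε / (K * √(sqInt μ f) + 1) * (K * √(sqInt μ f) + 1) := by gcongr; linarith
      _ = ε := by field_simp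
  -- Now `a * f` serves as its own test function, approximated in L² by a simple function to which
  -- `key` applies.
  refine ⟨haf, tendsto_avg_zero_of_approx (corr_nonneg _ _) fun ε hε => ?_⟩
  set h := fun x => a x * f x
  have hs0 : 0 ≤ √(sqInt μ h) := Real.sqrt_nonneg _
  obtain ⟨k, hk, hkm⟩ := haf.exists_simpleFunc_eLpNorm_sub_lt (by norm_num)
    (ε := ENNReal.ofReal (ε / (√(sqInt μ h) + 1))) (by simp; positivity)
  have hkT : MemLp k ∞ μ := by
    obtain ⟨C, hC⟩ := k.exists_forall_norm_le
    exact memLp_top_of_bound k.aestronglyMeasurable C (Eventually.of_forall hC)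
  have hd : MemLp (fun x => h x - k x) 2 μ := haf.sub hkm
  refine ⟨_, key k hkT, fun n => ?_⟩
  have h1 := corr_add_right_le (m := m) H.mp hkm hd haf n
  simp only [add_sub_cancel] at h1
  refine h1.trans (add_le_add_right ((corr_le H.mp haf hd n).trans ?_) _)
  have h2 : √(sqInt μ fun x => h x - k x) ≤ ε / (√(sqInt μ h) + 1) := by
    rw [sqInt_eq_toReal hd, Real.sqrt_sq ENNReal.toReal_nonneg]
    exact ENNReal.toReal_le_of_le_ofReal (by positivity) hk.le
  calc _ ≤ (√(sqInt μ h) + 1) * (ε / (√(sqInt μ h) + 1)) := by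
        gcongr
        linarith
    _ = ε := by field_simp

end Approximation

/-! ### Weak mixing as vanishing projection onto the multiplier algebra -/

section Projection

variable {X : Type*} {m mX : MeasurableSpace X} {μ : Measure X} {φ : X → X}

/-- The elementary kernel `(x, y) ↦ f (φⁿ x) * conj (f (φⁿ y))`. -/
def orbitPair (hφ : MeasurePreserving φ μ μ) {f : X → ℂ} (hf : MemLp f ∞ μ) (n : ℕ) :
    BddPair μ :=
  ⟨(fun x => f (φ^[n] x), fun x => f (φ^[n] x)), memLp_comp (hφ.iterate n) hf,
    memLp_comp (hφ.iterate n) hf⟩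

/-- The ergodic averages `(1/N) ∑_{n=1}^N` of the kernels `f ∘ φⁿ ⊗ conj (f ∘ φⁿ)`. -/
noncomputable def orbitAverage (hφ : MeasurePreserving φ μ μ) {f : X → ℂ} (hf : MemLp f ∞ μ)
    (N : ℕ) : BddPair μ →₀ ℂ :=
  birkhoffAverage ℂ (kernelShift hφ) id N (Finsupp.single (orbitPair hφ hf 1) 1)

theorem kernelShift_iterate_single (hφ : MeasurePreserving φ μ μ) {f : X → ℂ}
    (hf : MemLp f ∞ μ) (n : ℕ) :
    (kernelShift hφ)^[n] (Finsupp.single (orbitPair hφ hf 1) 1) =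
      Finsupp.single (orbitPair hφ hf (n + 1)) 1 := by
  induction n with
  | zero => rfl
  | succ n ih =>
    rw [Function.iterate_succ_apply', ih, kernelShift, Finsupp.lmapDomain_apply,
      Finsupp.mapDomain_single]
    rfl

/-- Birkhoff sums run over exponents `0, …, N - 1`; starting them at the orbit pair with index `1`
yields the indices `1, …, N` of the definition of weak mixing. -/
theorem kernelAct_orbitAverage (hφ : MeasurePreserving φ μ μ) {f : X → ℂ} (hf : MemLp f ∞ μ)
    (g : X → ℂ) (N : ℕ) (x : X) :
    kernelAct m μ g (orbitAverage hφ hf N) x = (N : ℂ)⁻¹ * ∑ n ∈ Finset.Icc 1 N,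
      f (φ^[n] x) * condIn m μ g (fun x => f (φ^[n] x)) x := by
  have e : ∀ a : ℕ → ℂ, ∑ n ∈ Finset.Icc 1 N, a n = ∑ n ∈ Finset.range N, a (n + 1) := by
    intro a
    rw [Finset.range_eq_Ico, Finset.sum_Ico_add' a 0 N 1]
    rfl
  rw [e, orbitAverage, birkhoffAverage, birkhoffSum]
  simp only [kernelShift_iterate_single, map_smul, map_sum, id, kernelAct,
    Finsupp.linearCombination_single, one_smul, Pi.smul_apply, Finset.sum_apply, smul_eq_mul]
  rfl

theorem kernelAct_orbitAverage_norm_le (hφ : MeasurePreserving φ μ μ) {f : X → ℂ}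
    (hf : MemLp f ∞ μ) {C : ℝ} (hC0 : 0 ≤ C) (hC : ∀ᵐ x ∂μ, ‖f x‖ ≤ C) (N : ℕ) :
    ∀ᵐ x ∂μ, ‖kernelAct m μ f (orbitAverage hφ hf N) x‖ ≤ C * (C * C) := by
  have h1 : ∀ᵐ x ∂μ, ∀ n, ‖f (φ^[n] x)‖ ≤ C := ae_all_iff.2 fun n => ae_comp_iterate hφ hC n
  have h2 : ∀ᵐ x ∂μ, ∀ n, ‖condIn m μ f (fun x => f (φ^[n] x)) x‖ ≤ C * C :=
    ae_all_iff.2 fun n => condIn_norm_le hC0 hC (ae_comp_iterate hφ hC n)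
  filter_upwards [h1, h2] with x h1 h2
  rw [kernelAct_orbitAverage, norm_mul, norm_inv, Complex.norm_natCast]
  refine (mul_le_mul_of_nonneg_left ((norm_sum_le _ _).trans (Finset.sum_le_sum
    (g := fun _ => C * (C * C)) fun n _ => ?_)) (by positivity)).trans ?_
  · rw [norm_mul]
    exact mul_le_mul (h1 n) (h2 n) (norm_nonneg _) hC0
  · simpa [avg] using avg_const_le (c := C * (C * C)) (by positivity) N

variable [IsProbabilityMeasure μ]

/-- In each term the factor `E(f ∘ φⁿ · conj f | m)` is `m`-measurable, so the remaining `f · conj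
(f ∘ φⁿ)` may be replaced by its conditional expectation, which is the complex conjugate of that
factor. -/
theorem integral_conj_kernelAct_orbitAverage (H : IsFactorAlgebra m μ φ) {f : X → ℂ}
    (hf : MemLp f ∞ μ) (N : ℕ) :
    ∫ x, conj (kernelAct m μ f (orbitAverage H.mp hf N) x) * f x ∂μ =
      (avg (fun n => sqInt μ (condIn m μ (fun x => f (φ^[n] x)) f)) N : ℂ) := by
  have hfn : ∀ n, MemLp (fun x => f (φ^[n] x)) ∞ μ := fun n => memLp_comp (H.mp.iterate n) hf
  have hterm : ∀ n, Integrable (fun x => conj (f (φ^[n] x) *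
      condIn m μ f (fun x => f (φ^[n] x)) x) * f x) μ := fun n =>
    integrable_of_memLp_top (memLp_top_mul (memLp_conj (memLp_top_mul (hfn n)
      (memLp_condIn hf (hfn n)))) hf)
  have h1 : ∀ n, ∫ x, conj (f (φ^[n] x) * condIn m μ f (fun x => f (φ^[n] x)) x) * f x ∂μ =
      (sqInt μ (condIn m μ (fun x => f (φ^[n] x)) f) : ℂ) := by
    intro n
    have h2 := integral_mul_condExp_eq (μ := μ) H.le
      (f := condIn m μ (fun x => f (φ^[n] x)) f) (g := fun x => f x * conj (f (φ^[n] x)))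
      stronglyMeasurable_condExp.aestronglyMeasurable
      (integrable_of_memLp_top (memLp_top_mul (memLp_condIn (hfn n) hf)
        (memLp_top_mul hf (memLp_conj (hfn n)))))
      (integrable_of_memLp_top (memLp_top_mul hf (memLp_conj (hfn n))))
    rw [sqInt, ← integral_complex_ofReal]
    calc _ = ∫ x, condIn m μ (fun x => f (φ^[n] x)) f x * (f x * conj (f (φ^[n] x))) ∂μ := by
          refine integral_congr_ae ?_
          filter_upwards [condIn_conj (m := m) hf (hfn n)] with x hx
          rw [map_mul, hx]
          ring
      _ = _ := by
          rw [← h2]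
          refine integral_congr_ae ?_
          filter_upwards [condIn_conj (m := m) (hfn n) hf] with x hx
          rw [Complex.ofReal_pow, ← Complex.mul_conj', hx]
          rfl
  simp only [kernelAct_orbitAverage, map_mul, map_sum, map_inv₀, map_natCast]
  simp only [mul_assoc ((N : ℂ)⁻¹), Finset.sum_mul]
  rw [integral_const_mul, integral_finsetSum _ fun n _ => by simpa only [map_mul] using hterm n]
  simp only [map_mul] at h1
  simp only [h1, avg]
  push_cast
  simp

/-- A bounded function with vanishing conditional expectation onto the multiplier algebra is
conditionally weakly mixing. -/
theorem isCondWeakMixing_of_condExp_eq_zero (H : IsFactorAlgebra m μ φ) {f : X → ℂ}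
    (hf : MemLp f ∞ μ) (h0 : μ[f | multiplierAlgebra H] =ᵐ[μ] 0) : IsCondWeakMixing m μ φ f := by
  obtain ⟨C, hC0, hC⟩ := exists_bound_of_memLp_top hf
  have hf2 : MemLp f 2 μ := hf.mono_exponent le_top
  set A := orbitAverage H.mp hf with hA
  set g : ℕ → X → ℂ := fun N => kernelAct m μ f (A N) with hg
  have hgT : ∀ N, MemLp (g N) ∞ μ := fun N => memLp_kernelAct hf _
  have hg2 : ∀ N, MemLp (g N) 2 μ := fun N => (hgT N).mono_exponent le_top
  have hgC : ∀ N, ∀ᵐ x ∂μ, ‖g N x‖ ≤ C * (C * C) := fun N =>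
    kernelAct_orbitAverage_norm_le H.mp hf hC0 hC N
  -- Equivariance writes `g N ∘ φⁿ` as the shifted kernel acting on `f ∘ φⁿ`. The mean ergodic
  -- estimate and the Hilbert–Schmidt bound then replace the shifted kernel by `A N₀`, uniformly in
  -- `n`. The case `n = 0` is the Cauchy property of `g`.
  have hnear : ∀ ε > 0, ∃ N₀, ∀ N ≥ N₀, ∀ n, sqInt μ (fun x => g N (φ^[n] x) -
      kernelAct m μ (fun x => f (φ^[n] x)) (A N₀) x) ≤ ε := by
    intro ε hε
    obtain ⟨N₀, hN₀⟩ := H.exists_kernel_near (Finsupp.single (orbitPair H.mp hf 1) 1)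
      (ε := ε / (C ^ 2 + 1)) (by positivity)
    refine ⟨N₀, fun N hN n => ?_⟩
    have h1 := hN₀ N hN n _ rfl
    have h2 := sqInt_kernelAct_le (m := m) (memLp_comp (H.mp.iterate n) hf)
      (ae_comp_iterate H.mp hC n) ((kernelShift H.mp)^[n] (A N) - A N₀)
    rw [map_sub] at h2
    have h3 := H.kernelAct_iterate hf (A N) n
    rw [sqInt_congr (g := fun x => g N (φ^[n] x) -
      kernelAct m μ (fun x => f (φ^[n] x)) (A N₀) x)
      (by filter_upwards [h3] with x hx; rw [Pi.sub_apply, hx])] at h2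
    refine h2.trans ?_
    calc _ ≤ (C ^ 2 + 1) * (ε / (C ^ 2 + 1)) := by
          gcongr
          · exact kernelInner_self_nonneg _
          · linarith
          · exact h1
      _ = ε := by field_simp
  obtain ⟨a, ha2, ha⟩ := exists_tendsto_of_sqInt_cauchy hg2 fun ε hε => by
    obtain ⟨N₀, hN₀⟩ := hnear ε hε
    exact ⟨N₀, fun N hN => hN₀ N hN 0⟩
  have haT : MemLp a ∞ μ := memLp_top_of_bound ha2.1 _ (ae_norm_le_of_tendsto ha2 hg2 hgC ha)
  -- `a ∘ φⁿ` is compared with `g N ∘ φⁿ`, at a distance independent of `n` by invariance of `μ`,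
  -- and then with `A N₀` acting on `f ∘ φⁿ`. The two errors `ε / 4` are each doubled by
  -- `sqInt_add_le`.
  have hmul : IsMultiplier m μ φ a := by
    refine isMultiplier_of_kernel_approx H haT hf fun ε hε => ?_
    obtain ⟨N₀, hN₀⟩ := hnear (ε / 4) (by positivity)
    obtain ⟨N, hNa, hN⟩ := ((ha.eventually (eventually_lt_nhds (by positivity : 0 < ε / 4))).and
      (eventually_ge_atTop N₀)).exists
    refine ⟨A N₀, fun n => ?_⟩
    have h1 := sqInt_add_le (μ := μ) (memLp_comp (H.mp.iterate n) (ha2.sub (hg2 N)))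
      ((memLp_comp (H.mp.iterate n) (hg2 N)).sub
        ((memLp_kernelAct (m := m) (memLp_comp (H.mp.iterate n) hf) (A N₀)).mono_exponent le_top))
    rw [sqInt_comp (H.mp.iterate n) (ha2.sub (hg2 N))] at h1
    simp only [Pi.sub_apply, sub_add_sub_cancel] at h1
    have h2 := hN₀ N hN n
    have h3 : sqInt μ (a - g N) < ε / 4 := hNa
    have h4 : sqInt μ ((fun x => g N (φ^[n] x)) -
      kernelAct m μ (fun x => f (φ^[n] x)) (A N₀)) ≤ ε / 4 := h2
    linarith
  have haf : ∫ x, conj (a x) * f x ∂μ = 0 := by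
    rw [← integral_mul_condExp_eq (multiplierAlgebra_le H)
      ((hmul.conj H).aestronglyMeasurable H)
      (integrable_of_memLp_top (memLp_top_mul (memLp_conj haT) hf)) (integrable_of_memLp_top hf)]
    rw [integral_congr_ae (g := fun _ => 0) (by filter_upwards [h0] with x hx; simp [hx]),
      integral_zero]
  have hlim : Tendsto (avg fun n => sqInt μ (condIn m μ (fun x => f (φ^[n] x)) f)) atTop
      (𝓝 0) := by
    have hb := (ha.sqrt).mul_const (√(sqInt μ f))
    rw [Real.sqrt_zero, zero_mul] at hb
    refine squeeze_zero (avg_nonneg fun n => sqInt_nonneg _) (fun N => ?_) hb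
    have h1 := norm_integral_mul_le (memLp_conj (ha2.sub (hg2 N))) hf2
    rw [sqInt_conj] at h1
    -- Since `a` is orthogonal to `f`, the average of squared norms is, up to sign, the pairing of
    -- `f` with `a - g N`, which tends to zero.
    have h2 : ∫ x, conj ((a - g N) x) * f x ∂μ =
        -(avg (fun n => sqInt μ (condIn m μ (fun x => f (φ^[n] x)) f)) N : ℂ) := by
      rw [← integral_conj_kernelAct_orbitAverage H hf N]
      simp only [Pi.sub_apply, map_sub, sub_mul]
      rw [integral_sub (integrable_mul_two (memLp_conj ha2) hf2)
        (integrable_mul_two (memLp_conj (hg2 N)) hf2), haf, zero_sub]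
    rw [h2, norm_neg, Complex.norm_real] at h1
    exact (le_abs_self _).trans h1
  -- The inequality `t ≤ t² / ε + ε` passes from squared L²-norms back to the L¹-norms of the
  -- conditional correlations.
  refine ⟨hf2, tendsto_avg_zero_of_approx (corr_nonneg _ _) fun ε hε =>
    ⟨_, tendsto_avg_zero_const_mul (1 / ε) hlim, fun n => ?_⟩⟩
  have hc : MemLp (condIn m μ (fun x => f (φ^[n] x)) f) 2 μ :=
    (memLp_condIn (memLp_comp (H.mp.iterate n) hf) hf).mono_exponent le_top
  have h1 : corr m μ φ f f n ≤
      ∫ x, (1 / ε * ‖condIn m μ (fun x => f (φ^[n] x)) f x‖ ^ 2 + ε) ∂μ := by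
    refine integral_mono integrable_condExp.norm
      (((integrable_norm_sq hc).const_mul _).add (integrable_const _)) fun x => ?_
    set t := ‖condIn m μ (fun x => f (φ^[n] x)) f x‖ with ht
    change t ≤ 1 / ε * t ^ 2 + ε
    have : 1 / ε * t ^ 2 + ε - t = ((t - ε / 2) ^ 2 + 3 / 4 * ε ^ 2) / ε := by
      field_simp; ring
    have h2 : 0 ≤ 1 / ε * t ^ 2 + ε - t := by rw [this]; positivity
    linarith
  rw [integral_add ((integrable_norm_sq hc).const_mul _) (integrable_const _),
    integral_const_mul] at h1
  simpa [sqInt] using h1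

/-- Conditionally weakly mixing functions are approximated in `L²` by bounded ones. -/
theorem IsCondWeakMixing.exists_bounded_near (H : IsFactorAlgebra m μ φ) {f : X → ℂ}
    (hf : IsCondWeakMixing m μ φ f) {ε : ℝ≥0∞} (hε : ε ≠ 0) :
    ∃ g, IsCondWeakMixing m μ φ g ∧ MemLp g ∞ μ ∧ eLpNorm (f - g) 2 μ < ε := by
  obtain ⟨k, hk, hkm, hkT⟩ : ∃ k : X → ℂ, eLpNorm (f - k) 2 μ < ε / 2 ∧ MemLp k 2 μ ∧
      MemLp k ∞ μ := by
    obtain ⟨k, hk, hkm⟩ := hf.1.exists_simpleFunc_eLpNorm_sub_lt (by norm_num)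
      (ε := ε / 2) (by simpa using hε)
    obtain ⟨C, hC⟩ := k.exists_forall_norm_le
    exact ⟨k, hk, hkm, memLp_top_of_bound k.aestronglyMeasurable C (Eventually.of_forall hC)⟩
  set Z := multiplierAlgebra H with hZ
  have hZle : Z ≤ mX := multiplierAlgebra_le H
  have hf1 : Integrable f μ := hf.1.integrable (by norm_num)
  have hk1 : Integrable k μ := integrable_of_memLp_top hkT
  have hpT : MemLp (μ[k | Z]) ∞ μ := hkT.condExp le_top
  have hgT : MemLp (k - μ[k | Z]) ∞ μ := hkT.sub hpT
  refine ⟨k - μ[k | Z], isCondWeakMixing_of_condExp_eq_zero H hgT ?_, hgT, ?_⟩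
  · have h1 := condExp_sub hk1 (integrable_condExp (μ := μ) (m := Z) (f := k)) Z
    have h2 := condExp_condExp_of_le (μ := μ) (f := k) (le_refl Z) hZle
    filter_upwards [h1, h2] with x h1 h2
    rw [h1, Pi.sub_apply, h2, sub_self, Pi.zero_apply]
  -- This uses `E(f | Z) = 0`, so that subtracting `E(f - k | Z)` adds back exactly `E(k | Z)`.
  · have h1 : f - (k - μ[k | Z]) =ᵐ[μ] (f - k) - μ[f - k | Z] := by
      filter_upwards [condExp_sub hf1 hk1 Z, hf.condExp_multiplierAlgebra H] with x h1 h2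
      simp only [Pi.sub_apply] at h1 ⊢
      rw [h1, h2, Pi.zero_apply]
      ring
    rw [eLpNorm_congr_ae h1]
    have hd : MemLp (f - k) 2 μ := hf.1.sub hkm
    calc _ ≤ eLpNorm (f - k) 2 μ + eLpNorm (μ[f - k | Z]) 2 μ :=
          eLpNorm_sub_le hd.1 (hd.condExp (by norm_num)).1 (by norm_num)
      _ < ε / 2 + ε / 2 := ENNReal.add_lt_add hk
          ((eLpNorm_condExp_le_eLpNorm _ (by norm_num)).trans_lt hk)
      _ = ε := ENNReal.add_halves ε

end Projection

/-! ### Pointwise form of the Koopman iterates -/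

section Koopman

variable {X : Type*} [MeasurableSpace X] {μ : Measure X} {φ : X ≃ᵐ X}

theorem koopman_coeFn {p : ℝ≥0∞} (hφ : MeasurePreserving φ μ μ) (f : Lp ℂ p μ) :
    koopman p hφ f =ᵐ[μ] fun x => f (φ x) :=
  Lp.coeFn_compMeasurePreserving f hφ

theorem koopman_iterate_coeFn {p : ℝ≥0∞} (hφ : MeasurePreserving φ μ μ) (f : Lp ℂ p μ) (n : ℕ) :
    (koopman p hφ)^[n] f =ᵐ[μ] fun x => f (φ^[n] x) := by
  induction n with
  | zero => rfl
  | succ n ih =>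
    rw [Function.iterate_succ_apply']
    filter_upwards [koopman_coeFn hφ ((koopman p hφ)^[n] f),
      hφ.quasiMeasurePreserving.ae ih] with x h1 h2
    rw [h1, h2, Function.iterate_succ_apply]

end Koopman

/-! ### From the Markov factor map to a σ-algebra on `X` -/

section MarkovFactor

variable {X Y : Type*} [MeasurableSpace X] [MeasurableSpace Y]
  {μ : Measure X} {ν : Measure Y} [IsProbabilityMeasure μ] [IsProbabilityMeasure ν]
  {J : Lp ℂ 1 ν →L[ℂ] Lp ℂ 1 μ}

/-- The indicator function of a measurable set as an element of `L¹`. -/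
noncomputable def indL (ν : Measure Y) [IsProbabilityMeasure ν] {C : Set Y}
    (hC : MeasurableSet C) : Lp ℂ 1 ν :=
  indicatorConstLp 1 hC (measure_ne_top ν C) (1 : ℂ)

theorem indL_coeFn {C : Set Y} (hC : MeasurableSet C) :
    indL ν hC =ᵐ[ν] C.indicator fun _ => 1 :=
  indicatorConstLp_coeFn

theorem IsMarkovHom.mono (hJ : IsMarkovHom J) {f g : Lp ℂ 1 ν} (h : ∀ᵐ y ∂ν, f y ≤ g y) :
    ∀ᵐ x ∂μ, J f x ≤ J g x := by
  have h1 := hJ.nonneg (g - f) (by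
    filter_upwards [h, Lp.coeFn_sub g f] with y h1 h2
    rw [h2, Pi.sub_apply, sub_nonneg]
    exact h1)
  rw [map_sub] at h1
  filter_upwards [h1, Lp.coeFn_sub (J g) (J f)] with x h1 h2
  rwa [h2, Pi.sub_apply, sub_nonneg] at h1

/-- A Markov homomorphism maps indicator functions to indicator functions. -/
theorem IsMarkovHom.exists_indL (hJ : IsMarkovHom J) {C : Set Y} (hC : MeasurableSet C) :
    ∃ B, ∃ hB : MeasurableSet B, J (indL ν hC) = indL μ hB := by
  set h := J (indL ν hC) with hh
  have h0 : ∀ᵐ x ∂μ, 0 ≤ h x := hJ.nonneg _ (by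
    filter_upwards [indL_coeFn (ν := ν) hC] with y hy
    rw [hy]
    exact Set.indicator_nonneg (fun _ _ => zero_le_one) y)
  -- `|2 · 1_C - 1| = 1`, and `J` preserves absolute values, so `|2h - 1| = 1`. As `h` is real, its
  -- only possible values are `0` and `1`.
  have h1 := hJ.map_abs ((2 : ℂ) • indL ν hC - Lp.const 1 ν (1 : ℂ)) (Lp.const 1 ν (1 : ℂ)) (by
    filter_upwards [Lp.coeFn_sub ((2 : ℂ) • indL ν hC) (Lp.const 1 ν (1 : ℂ)),
      Lp.coeFn_smul (2 : ℂ) (indL ν hC), Lp.coeFn_const (p := 1) (μ := ν) (c := (1 : ℂ)),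
      indL_coeFn (ν := ν) hC] with y a b c d
    rw [a, Pi.sub_apply, b, Pi.smul_apply, c, d]
    by_cases hy : y ∈ C
    · simp [hy]; norm_num
    · simp [hy])
  rw [map_sub, map_smul, hJ.map_one] at h1
  have hB : MeasurableSet {x | h x = 1} :=
    (Lp.stronglyMeasurable h).measurable (measurableSet_singleton 1)
  refine ⟨_, hB, Lp.ext ?_⟩
  filter_upwards [h0, h1, Lp.coeFn_sub ((2 : ℂ) • h) (Lp.const 1 μ (1 : ℂ)),
    Lp.coeFn_smul (2 : ℂ) h, Lp.coeFn_const (p := 1) (μ := μ) (c := (1 : ℂ)),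
    indL_coeFn (ν := μ) hB] with x h0 h1 a b c d
  rw [d]
  rw [c, a, Pi.sub_apply, b, Pi.smul_apply, c] at h1
  obtain ⟨r, hr⟩ : ∃ r : ℝ, h x = r := ⟨(h x).re, Complex.ext rfl (Complex.le_def.1 h0).2.symm⟩
  by_cases hx : h x = 1
  · rw [Set.indicator_of_mem (by exact hx), hx]
  · rw [Set.indicator_of_notMem (by exact hx)]
    rw [hr] at h1 hx ⊢
    have h2 : ‖((2 * r - 1 : ℝ) : ℂ)‖ = 1 := by
      have : (1 : ℂ) = (‖(2 : ℂ) • (r : ℂ) - 1‖ : ℂ) := h1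
      rw [smul_eq_mul] at this
      have e : (2 : ℂ) * r - 1 = ((2 * r - 1 : ℝ) : ℂ) := by push_cast; ring
      rw [e] at this
      exact (Complex.ofReal_injective (by rw [Complex.ofReal_one]; exact this)).symm
    rw [Complex.norm_real, Real.norm_eq_abs] at h2
    have h3 : r ≠ 1 := fun h => hx (by rw [h]; rfl)
    have h4 : r = 0 := by
      rcases abs_eq zero_le_one |>.1 h2 with h | h
      · exact absurd (by linarith) h3
      · linarith
    rw [h4]; rfl

/-- The image is an indicator `1_E`, and monotonicity squeezes it: `1_B ≤ 1_E`, `1_A ≤ 1_E` and `1_E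
≤ 1_B + 1_A` force `E = B ∪ A` almost everywhere. -/
theorem IsMarkovHom.map_indL_union (hJ : IsMarkovHom J) {C D : Set Y} {hC : MeasurableSet C}
    {hD : MeasurableSet D} {B A : Set X} {hB : MeasurableSet B} {hA : MeasurableSet A}
    (h1 : J (indL ν hC) = indL μ hB) (h2 : J (indL ν hD) = indL μ hA) :
    J (indL ν (hC.union hD)) = indL μ (hB.union hA) := by
  obtain ⟨E, hE, h3⟩ := hJ.exists_indL (hC.union hD)
  have a1 := hJ.mono (f := indL ν hC) (g := indL ν (hC.union hD)) (by
    filter_upwards [indL_coeFn (ν := ν) hC, indL_coeFn (ν := ν) (hC.union hD)] with y a b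
    rw [a, b]
    by_cases hy : y ∈ C <;> by_cases hy' : y ∈ D <;> simp [hy, hy'])
  have a2 := hJ.mono (f := indL ν hD) (g := indL ν (hC.union hD)) (by
    filter_upwards [indL_coeFn (ν := ν) hD, indL_coeFn (ν := ν) (hC.union hD)] with y a b
    rw [a, b]
    by_cases hy : y ∈ C <;> by_cases hy' : y ∈ D <;> simp [hy, hy'])
  have a3 := hJ.mono (f := indL ν (hC.union hD)) (g := indL ν hC + indL ν hD) (by
    filter_upwards [indL_coeFn (ν := ν) hC, indL_coeFn (ν := ν) hD,
      indL_coeFn (ν := ν) (hC.union hD), Lp.coeFn_add (indL ν hC) (indL ν hD)] with y a b c d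
    rw [d, Pi.add_apply, a, b, c]
    by_cases hy : y ∈ C <;> by_cases hy' : y ∈ D <;> simp [hy, hy'])
  rw [map_add] at a3
  rw [h3, h1] at a1
  rw [h3, h2] at a2
  rw [h3, h1, h2] at a3
  rw [h3]
  refine Lp.ext ?_
  filter_upwards [a1, a2, a3, indL_coeFn (ν := μ) hB, indL_coeFn (ν := μ) hA,
    indL_coeFn (ν := μ) hE, Lp.coeFn_add (indL μ hB) (indL μ hA),
    indL_coeFn (ν := μ) (hB.union hA)] with x a1 a2 a3 b1 b2 b3 b4 b5
  rw [b1, b3] at a1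
  rw [b2, b3] at a2
  rw [b4, Pi.add_apply, b1, b2, b3] at a3
  rw [b3, b5]
  have hn : ¬ (1 : ℂ) ≤ 0 := fun h => by
    have := (Complex.le_def.1 h).1
    norm_num at this
  by_cases hxB : x ∈ B <;> by_cases hxA : x ∈ A <;> by_cases hxE : x ∈ E <;>
    simp_all

theorem indL_compl {C : Set Y} (hC : MeasurableSet C) :
    indL ν hC.compl = Lp.const 1 ν (1 : ℂ) - indL ν hC := by
  refine Lp.ext ?_
  filter_upwards [indL_coeFn (ν := ν) hC.compl, indL_coeFn (ν := ν) hC,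
    Lp.coeFn_const (p := 1) (μ := ν) (c := (1 : ℂ)),
    Lp.coeFn_sub (Lp.const 1 ν (1 : ℂ)) (indL ν hC)] with y a b c d
  rw [a, d, Pi.sub_apply, b, c]
  by_cases hy : y ∈ C <;> simp [hy]

theorem tendsto_indL_accumulate {C : ℕ → Set Y} (hC : ∀ n, MeasurableSet (C n))
    (hA : ∀ n, MeasurableSet (Set.accumulate C n)) :
    Tendsto (fun n => indL ν (hA n)) atTop (𝓝 (indL ν (MeasurableSet.iUnion hC))) := by
  refine tendsto_indicatorConstLp_set ENNReal.one_ne_top ?_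
  have h1 : Tendsto (fun n => ν (⋃ i, C i) - ν (Set.accumulate C n)) atTop (𝓝 0) := by
    have := ENNReal.Tendsto.sub (tendsto_const_nhds (x := ν (⋃ i, C i)))
      (tendsto_measure_iUnion_accumulate (μ := ν) (f := C)) (Or.inl (measure_ne_top ν _))
    simpa using this
  refine h1.congr fun n => ?_
  have hsub : Set.accumulate C n ⊆ ⋃ i, C i := by
    rw [← Set.iUnion_accumulate]
    exact Set.subset_iUnion _ n
  rw [← measure_sdiff hsub (hA n).nullMeasurableSet (measure_ne_top ν _), symmDiff_def]
  simp [Set.sdiff_eq_empty.2 hsub]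

/-- The `σ`-algebra on `X` of all sets whose indicator functions are in the range of `J`. -/
@[reducible]
def factorAlgebra (hJ : IsMarkovHom J) : MeasurableSpace X where
  MeasurableSet' B := ∃ hB : MeasurableSet B, ∃ C, ∃ hC : MeasurableSet C,
    J (indL ν hC) = indL μ hB
  measurableSet_empty := by
    refine ⟨MeasurableSet.empty, ∅, MeasurableSet.empty, ?_⟩
    simp only [indL, indicatorConstLp_empty, map_zero]
  measurableSet_compl := by
    rintro B ⟨hB, C, hC, h⟩
    refine ⟨hB.compl, Cᶜ, hC.compl, ?_⟩
    rw [indL_compl hC, indL_compl hB, map_sub, hJ.map_one, h]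
  measurableSet_iUnion := by
    intro B hB
    choose hB C hC h using hB
    have hCA : ∀ n, MeasurableSet (Set.accumulate C n) := fun n =>
      MeasurableSet.biUnion (Set.to_countable _) fun i _ => hC i
    have hBA : ∀ n, MeasurableSet (Set.accumulate B n) := fun n =>
      MeasurableSet.biUnion (Set.to_countable _) fun i _ => hB i
    refine ⟨MeasurableSet.iUnion hB, _, MeasurableSet.iUnion hC, ?_⟩
    have hfin : ∀ n, J (indL ν (hCA n)) = indL μ (hBA n) := by
      intro n
      induction n with
      | zero => simpa only [Set.accumulate_zero_nat] using h 0
      | succ n ih => simpa only [Set.accumulate_succ] using hJ.map_indL_union ih (h (n + 1))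
    refine tendsto_nhds_unique ((J.continuous.tendsto _).comp (tendsto_indL_accumulate hC hCA)) ?_
    exact (tendsto_indL_accumulate hB hBA).congr fun n => (hfin n).symm

theorem factorAlgebra_le (hJ : IsMarkovHom J) : factorAlgebra hJ ≤ ‹MeasurableSpace X› :=
  fun _ hB => hB.choose

theorem IsMarkovHom.aestronglyMeasurable (hJ : IsMarkovHom J) (g : Lp ℂ 1 ν) :
    AEStronglyMeasurable[factorAlgebra hJ] (J g) μ := by
  refine Lp.induction ENNReal.one_ne_top
    (fun g => AEStronglyMeasurable[factorAlgebra hJ] (J g) μ) ?_ ?_ ?_ g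
  · intro c C hC hν
    obtain ⟨B, hB, h⟩ := hJ.exists_indL hC
    have e : (Lp.simpleFunc.indicatorConst 1 hC hν.ne c : Lp ℂ 1 ν) = c • indL ν hC := by
      rw [Lp.simpleFunc.coe_indicatorConst]
      refine Lp.ext ?_
      filter_upwards [indicatorConstLp_coeFn (p := 1) (hs := hC) (hμs := hν.ne) (c := c),
        Lp.coeFn_smul c (indL ν hC), indL_coeFn (ν := ν) hC] with y a b d
      rw [a, b, Pi.smul_apply, d]
      by_cases hy : y ∈ C <;> simp [hy]
    rw [e, map_smul, h]
    have hB' : MeasurableSet[factorAlgebra hJ] B := ⟨hB, C, hC, h⟩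
    refine ⟨B.indicator fun _ => c, stronglyMeasurable_const.indicator hB', ?_⟩
    filter_upwards [Lp.coeFn_smul c (indL μ hB), indL_coeFn (ν := μ) hB] with x a b
    rw [a, Pi.smul_apply, b]
    by_cases hx : x ∈ B <;> simp [hx]
  · rintro a b ha hb - h1 h2
    rw [map_add]
    exact (h1.add h2).congr (Lp.coeFn_add _ _).symm
  · exact (isClosed_aestronglyMeasurable (factorAlgebra_le hJ)).preimage J.continuous

/-- Both sides are additive and continuous in `g`, so indicators suffice. There it says that
corresponding intersections have equal measure, which holds because `J` preserves integrals. -/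
theorem IsMarkovHom.setIntegral_eq (hJ : IsMarkovHom J) {C : Set Y} {hC : MeasurableSet C}
    {B : Set X} {hB : MeasurableSet B} (h : J (indL ν hC) = indL μ hB) (g : Lp ℂ 1 ν) :
    ∫ x in B, J g x ∂μ = ∫ y in C, g y ∂ν := by
  refine Lp.induction ENNReal.one_ne_top
    (fun g => ∫ x in B, J g x ∂μ = ∫ y in C, g y ∂ν) ?_ ?_ ?_ g
  · intro c D hD hν
    obtain ⟨A, hA, h'⟩ := hJ.exists_indL hD
    have e : (Lp.simpleFunc.indicatorConst 1 hD hν.ne c : Lp ℂ 1 ν) = c • indL ν hD := by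
      rw [Lp.simpleFunc.coe_indicatorConst]
      refine Lp.ext ?_
      filter_upwards [indicatorConstLp_coeFn (p := 1) (hs := hD) (hμs := hν.ne) (c := c),
        Lp.coeFn_smul c (indL ν hD), indL_coeFn (ν := ν) hD] with y a b d
      rw [a, b, Pi.smul_apply, d]
      by_cases hy : y ∈ D <;> simp [hy]
    have hcompl : ∀ {C : Set Y} {hC : MeasurableSet C} {B : Set X} {hB : MeasurableSet B},
        J (indL ν hC) = indL μ hB → J (indL ν hC.compl) = indL μ hB.compl := by
      intro C hC B hB h
      rw [indL_compl hC, indL_compl hB, map_sub, hJ.map_one, h]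
    -- The intersection is reached through De Morgan from complements and a union.
    have hint : μ.real (B ∩ A) = ν.real (C ∩ D) := by
      have h3 := hcompl (hJ.map_indL_union (hcompl h) (hcompl h'))
      have h4 := hJ.integral_eq (indL ν (hC.compl.union hD.compl).compl)
      rw [h3, integral_congr_ae (indL_coeFn _), integral_congr_ae (indL_coeFn _),
        integral_indicator (hB.compl.union hA.compl).compl,
        integral_indicator (hC.compl.union hD.compl).compl] at h4
      simpa [Set.compl_union] using h4
    have i1 : ∫ x in B, J (c • indL ν hD) x ∂μ = μ.real (B ∩ A) • c := by
      rw [map_smul, h']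
      rw [integral_congr_ae (g := A.indicator fun _ => c), integral_indicator hA,
        Measure.restrict_restrict hA, setIntegral_const, Set.inter_comm]
      refine ae_restrict_of_ae ?_
      filter_upwards [Lp.coeFn_smul c (indL μ hA), indL_coeFn (ν := μ) hA] with x a b
      rw [a, Pi.smul_apply, b]
      by_cases hx : x ∈ A <;> simp [hx]
    have i2 : ∫ y in C, (c • indL ν hD : Lp ℂ 1 ν) y ∂ν = ν.real (C ∩ D) • c := by
      rw [integral_congr_ae (g := D.indicator fun _ => c), integral_indicator hD,
        Measure.restrict_restrict hD, setIntegral_const, Set.inter_comm]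
      refine ae_restrict_of_ae ?_
      filter_upwards [Lp.coeFn_smul c (indL ν hD), indL_coeFn (ν := ν) hD] with x a b
      rw [a, Pi.smul_apply, b]
      by_cases hx : x ∈ D <;> simp [hx]
    rw [e, i1, i2, hint]
  · rintro a b ha hb - h1 h2
    rw [map_add]
    set a' := ha.toLp
    set b' := hb.toLp
    rw [integral_congr_ae (ae_restrict_of_ae (Lp.coeFn_add (J a') (J b'))),
      integral_congr_ae (ae_restrict_of_ae (Lp.coeFn_add a' b'))]
    simp only [Pi.add_apply]
    rw [integral_add (L1.integrable_coeFn _).integrableOn (L1.integrable_coeFn _).integrableOn,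
      integral_add (L1.integrable_coeFn _).integrableOn (L1.integrable_coeFn _).integrableOn,
      h1, h2]
  · exact isClosed_eq ((continuous_setIntegral B).comp J.continuous) (continuous_setIntegral C)

/-- The operator `J J'` is the conditional expectation onto the factor algebra. -/
theorem IsMarkovHom.map_condExpY (hJ : IsMarkovHom J) (f : Lp ℂ 1 μ) :
    J (condExpY hJ f) =ᵐ[μ] μ[f | factorAlgebra hJ] := by
  refine ae_eq_condExp_of_forall_setIntegral_eq (factorAlgebra_le hJ) (L1.integrable_coeFn f)
    (fun _ _ _ => (L1.integrable_coeFn _).integrableOn) ?_ (hJ.aestronglyMeasurable _)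
  rintro B ⟨hB, C, hC, h⟩ -
  have hT : MemLp (indL ν hC) ∞ ν := by
    refine (memLp_congr_ae (indL_coeFn hC)).2 ?_
    exact memLp_indicator_const ∞ hC (1 : ℂ) (Or.inr (measure_ne_top ν C))
  have h1 := condExpY_spec hJ f _ hT
  rw [h] at h1
  rw [hJ.setIntegral_eq h, ← integral_indicator hC, ← integral_indicator hB]
  calc _ = ∫ y, condExpY hJ f y * indL ν hC y ∂ν := by
        refine integral_congr_ae ?_
        filter_upwards [indL_coeFn (ν := ν) hC] with y hy
        rw [hy]
        by_cases hyC : y ∈ C <;> simp [hyC]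
    _ = ∫ x, f x * indL μ hB x ∂μ := h1
    _ = _ := by
        refine integral_congr_ae ?_
        filter_upwards [indL_coeFn (ν := μ) hB] with y hy
        rw [hy]
        by_cases hyC : y ∈ B <;> simp [hyC]

/-- `|J g| = J |g|`, and `J` preserves integrals. -/
theorem IsMarkovHom.norm_eq (hJ : IsMarkovHom J) (g : Lp ℂ 1 ν) :
    ‖g‖ = ∫ x, ‖J g x‖ ∂μ := by
  have hm : MemLp (fun y => (‖g y‖ : ℂ)) 1 ν := (Lp.memLp g).norm.ofReal
  have h1 := hJ.map_abs g hm.toLp hm.coeFn_toLp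
  have h2 := hJ.integral_eq hm.toLp
  rw [integral_congr_ae h1, integral_congr_ae hm.coeFn_toLp, integral_complex_ofReal,
    integral_complex_ofReal] at h2
  rw [L1.norm_eq_integral_norm]
  exact_mod_cast h2.symm

variable {φ : X ≃ᵐ X} {hφ : MeasurePreserving φ μ μ} {ψ : Y ≃ᵐ Y} {hψ : MeasurePreserving ψ ν ν}

/-- By invertibility of `φ`, an integral over `B` of a function composed with `φ` is an integral
over `φ(B)`, so it must be seen that `φ(B)` is in the factor algebra and that `E(f | m) ∘ φ` is
measurable for it. Both follow from intertwining. -/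
theorem IsMarkovFactorMap.isFactorAlgebra (hJ : IsMarkovFactorMap hφ hψ J) :
    IsFactorAlgebra (factorAlgebra hJ.toIsMarkovHom) μ φ := by
  refine ⟨factorAlgebra_le _, hφ, fun f hf => ?_⟩
  have hm := factorAlgebra_le hJ.toIsMarkovHom
  refine (ae_eq_condExp_of_forall_setIntegral_eq hm (integrable_comp hφ hf)
    (fun _ _ _ => (integrable_comp hφ integrable_condExp).integrableOn) ?_ ?_).symm
  · rintro B ⟨hB, C, hC, h⟩ -
    have hB' : MeasurableSet (φ.symm ⁻¹' B) := φ.symm.measurable hB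
    have hC' : MeasurableSet (ψ.symm ⁻¹' C) := ψ.symm.measurable hC
    have hpre : φ ⁻¹' (φ.symm ⁻¹' B) = B := by ext x; simp
    -- If `J 1_C = 1_B`, then `T (J 1_{ψ(C)}) = J 1_C = 1_B`, and undoing `T` gives `J 1_{ψ(C)} =
    -- 1_{φ(B)}`.
    have hBm : MeasurableSet[factorAlgebra hJ.toIsMarkovHom] (φ.symm ⁻¹' B) := by
      refine ⟨hB', _, hC', Lp.ext ?_⟩
      have h1 := hJ.intertwine (indL ν hC')
      have h2 : koopman 1 hψ (indL ν hC') = indL ν hC := by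
        refine Lp.ext ?_
        filter_upwards [koopman_coeFn hψ (indL ν hC'),
          hψ.quasiMeasurePreserving.ae (indL_coeFn (ν := ν) hC'), indL_coeFn (ν := ν) hC]
          with y a b c
        rw [a, b, c]
        have hy : ψ y ∈ ψ.symm ⁻¹' C ↔ y ∈ C := by simp
        by_cases hyC : y ∈ C
        · rw [Set.indicator_of_mem hyC, Set.indicator_of_mem (hy.2 hyC)]
        · rw [Set.indicator_of_notMem hyC, Set.indicator_of_notMem (mt hy.1 hyC)]
      rw [h2, h] at h1
      have h3 : indL μ hB =ᵐ[μ] fun x => J (indL ν hC') (φ x) := by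
        rw [h1]; exact koopman_coeFn hφ _
      have h4 := (hφ.symm φ).quasiMeasurePreserving.ae (h3.symm.trans (indL_coeFn (ν := μ) hB))
      filter_upwards [h4, indL_coeFn (ν := μ) hB'] with x a b
      rw [b]
      rw [MeasurableEquiv.apply_symm_apply] at a
      rw [a]
      rfl
    have e : ∀ k : X → ℂ, ∫ x in B, k (φ x) ∂μ = ∫ x in φ.symm ⁻¹' B, k x ∂μ := fun k => by
      conv_lhs => rw [← hpre]
      exact hφ.setIntegral_preimage_emb φ.measurableEmbedding k _
    rw [e, e, setIntegral_condExp hm hf hBm]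
  -- Writing `E(f | m)` as `J E_Y f` gives `E(f | m) ∘ φ = T J E_Y f = J S E_Y f`, which lies in the
  -- range of `J`.
  · have h1 := hJ.toIsMarkovHom.map_condExpY hf.toL1
    have h2 : μ[hf.toL1 | factorAlgebra hJ.toIsMarkovHom] =ᵐ[μ]
      μ[f | factorAlgebra hJ.toIsMarkovHom] := condExp_congr_ae hf.coeFn_toL1
    have h3 := hφ.quasiMeasurePreserving.ae (h1.trans h2)
    refine (hJ.toIsMarkovHom.aestronglyMeasurable
      (koopman 1 hψ (condExpY hJ.toIsMarkovHom hf.toL1))).congr ?_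
    rw [hJ.intertwine]
    filter_upwards [koopman_coeFn hφ (J (condExpY hJ.toIsMarkovHom hf.toL1)), h3] with x a b
    rw [a, b]

theorem norm_condInner_koopman (hJ : IsMarkovHom J) (hφ : MeasurePreserving φ μ μ)
    (f : Lp ℂ 2 μ) (n : ℕ) :
    ‖condInner hJ ((koopman 2 hφ)^[n] f) f‖ = corr (factorAlgebra hJ) μ φ f f n := by
  rw [condInner, hJ.norm_eq, corr]
  refine integral_congr_ae ?_
  have h1 : mulConj ((koopman 2 hφ)^[n] f) f =ᵐ[μ] fun x => f (φ^[n] x) * conj (f x) := by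
    refine (MemLp.coeFn_toLp _).trans ?_
    filter_upwards [koopman_iterate_coeFn hφ f n] with x hx
    rw [hx]
  filter_upwards [hJ.map_condExpY (mulConj ((koopman 2 hφ)^[n] f) f),
    condExp_congr_ae (m := factorAlgebra hJ) h1] with x a b
  rw [a, b]

theorem mem_condWeakMixing_iff (hJ : IsMarkovHom J) (hφ : MeasurePreserving φ μ μ)
    (f : Lp ℂ 2 μ) :
    f ∈ condWeakMixing hφ hJ ↔ IsCondWeakMixing (factorAlgebra hJ) μ φ f := by
  have e : (fun N : ℕ => (1 / (N : ℝ)) *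
      ∑ n ∈ Finset.Icc 1 N, ‖condInner hJ ((koopman 2 hφ)^[n] f) f‖) =
      avg (corr (factorAlgebra hJ) μ φ f f) := by
    ext N
    simp only [norm_condInner_koopman, avg]
  rw [condWeakMixing, Set.mem_ofPred_eq, e]
  exact ⟨fun h => ⟨Lp.memLp f, h⟩, fun h => h.2⟩

end MarkovFactor

end CondErgodic

/-! ### Density of the bounded weakly mixing functions -/

open CondErgodic in
theorem mainTheorem5 {X Y : Type*} [MeasurableSpace X] [MeasurableSpace Y]
    (μ : Measure X) (ν : Measure Y) [IsProbabilityMeasure μ] [IsProbabilityMeasure ν]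
    (φ : X ≃ᵐ X) (hφ : MeasurePreserving φ μ μ)
    (ψ : Y ≃ᵐ Y) (hψ : MeasurePreserving ψ ν ν)
    (J : Lp ℂ 1 ν →L[ℂ] Lp ℂ 1 μ) (hJ : CondErgodic.IsMarkovFactorMap hφ hψ J) :
    CondErgodic.condWeakMixing hφ hJ.toIsMarkovHom ⊆
      closure (CondErgodic.condWeakMixing hφ hJ.toIsMarkovHom ∩
        {f : Lp ℂ 2 μ | MemLp f ∞ μ}) := by
  intro f hf
  have H := hJ.isFactorAlgebra
  rw [mem_condWeakMixing_iff] at hf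
  rw [EMetric.mem_closure_iff]
  intro ε hε
  obtain ⟨g, hg, hgT, hfg⟩ := hf.exists_bounded_near H hε.ne'
  refine ⟨hg.1.toLp, ⟨?_, ?_⟩, ?_⟩
  · rw [mem_condWeakMixing_iff]
    exact hg.congr H hg.1.coeFn_toLp.symm
  · exact (memLp_congr_ae hg.1.coeFn_toLp).2 hgT
  · rw [Lp.edist_def]
    refine (eLpNorm_congr_ae ?_).trans_lt hfg
    filter_upwards [hg.1.coeFn_toLp] with x hx
    simp only [Pi.sub_apply, hx]
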